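/- Let $K$ be a field of characteristic $0$ and let $A_n(K)$ be the Weyl algebra, i.e. the $K$-algebra of operators on $K[x_1,\dots,x_n]$ generated by the multiplications by $x_1,\dots,x_n$ and the partial derivatives $\partial_1,\dots,\partial_n$. For integers $r,s$ let $W_r$ (respectively $W_{rs}$) be the $K$-span in $A_n(K)$ of all monomials $x^\alpha\partial^\beta$ with $|\alpha|+|\beta|\le r$ (respectively with $|\alpha|\le r$ and $|\beta|\le s$). Then $W_r\subseteq W_{rr}\subseteq W_{2r}$ for all $r\in\mathbb N$. Let $M$ be a nonzero left $A_n(K)$-module generated by finitely many elements $g_1,\dots,g_p$. Then there are a unique polynomial $\psi_M(t)\in\mathbb Q[t]$ (the Bernstein polynomial of the system $g_1,\dots,g_p$) with $\psi_M(r)=\dim_K\sum_{i=1}^p W_r g_i$ for all sufficiently large integers $r$, and a unique polynomial $\phi_M(t_1,t_2)\in\mathbb Q[t_1,t_2]$ (the characteristic polynomial of the same system) with $\phi_M(r,s)=\dim_K\sum_{i=1}^p W_{rs}g_i$ for all sufficiently large integers $r$ and $s$. They satisfy $$\psi_M(r)\le\phi_M(r,r)\le\psi_M(2r)$$ for all sufficiently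 large integers $r$. Moreover $$n\le\deg\psi_M=\deg\phi_M\le 2n,$$ where $\deg\phi_M$ is the total degree. In particular, $M$ belongs to the Bernstein class $\mathcal B_n$ (the class of finitely generated left $A_n(K)$-modules having a Bernstein polynomial of degree $n$ with respect to some finite system of generators) if and only if $\deg\phi_M=n$. -/

import Mathlib

noncomputable section

/-- The Weyl algebra `A_n(K)`: the `K`-algebra of operators on `K[x_1, …, x_n]` generated by the
multiplications by the variables and the partial derivatives. -/
def WeylAlgebra (K : Type*) [Field K] (n : ℕ) :
    Subalgebra K (Module.End K (MvPolynomial (Fin n) K)) :=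
  Algebra.adjoin K
    (Set.range (fun i : Fin n => LinearMap.mulLeft K (MvPolynomial.X i : MvPolynomial (Fin n) K)) ∪
      Set.range (fun i : Fin n =>
        (MvPolynomial.pderiv i :
          Derivation K (MvPolynomial (Fin n) K) (MvPolynomial (Fin n) K)).toLinearMap))

namespace WeylAlgebra

/-- The element `x_i` of `A_n(K)`: multiplication by the variable `x_i`. -/
def x (K : Type*) [Field K] {n : ℕ} (i : Fin n) : WeylAlgebra K n :=
  ⟨LinearMap.mulLeft K (MvPolynomial.X i), Algebra.subset_adjoin (Or.inl ⟨i, rfl⟩)⟩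

/-- The element `∂_i` of `A_n(K)`: partial differentiation with respect to `x_i`. -/
def d (K : Type*) [Field K] {n : ℕ} (i : Fin n) : WeylAlgebra K n :=
  ⟨(MvPolynomial.pderiv i).toLinearMap, Algebra.subset_adjoin (Or.inr ⟨i, rfl⟩)⟩

/-- The monomial `x^α ∂^β = x_1^{α_1} ⋯ x_n^{α_n} ∂_1^{β_1} ⋯ ∂_n^{β_n}`. -/
def monomial (K : Type*) [Field K] {n : ℕ} (α β : Fin n → ℕ) : WeylAlgebra K n :=
  (List.ofFn fun i => x K i ^ α i).prod * (List.ofFn fun i => d K i ^ β i).prod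

/-- The Bernstein filtration `W_r`: the operators of order at most `r`, that is, the `K`-linear
combinations of monomials `x^α ∂^β` with `|α| + |β| ≤ r`. It is zero for `r < 0`. -/
def W (K : Type*) [Field K] (n : ℕ) (r : ℤ) : Submodule K (WeylAlgebra K n) :=
  Submodule.span K
    {D | ∃ α β : Fin n → ℕ, (((∑ i, α i) + ∑ i, β i : ℕ) : ℤ) ≤ r ∧ D = monomial K α β}

/-- The bifiltration `W_{rs}`: the `K`-linear combinations of monomials `x^α ∂^β` with `|α| ≤ r`
and `|β| ≤ s`. It is zero if `r < 0` or `s < 0`. -/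
def W₂ (K : Type*) [Field K] (n : ℕ) (r s : ℤ) : Submodule K (WeylAlgebra K n) :=
  Submodule.span K
    {D | ∃ α β : Fin n → ℕ,
      ((∑ i, α i : ℕ) : ℤ) ≤ r ∧ ((∑ i, β i : ℕ) : ℤ) ≤ s ∧ D = monomial K α β}

section Modules

variable {K : Type*} [Field K] {n : ℕ} {M : Type*} [AddCommGroup M] [Module K M]
  [Module (WeylAlgebra K n) M] [IsScalarTower K (WeylAlgebra K n) M] {p : ℕ}

/-- For a `K`-subspace `V` of `A_n(K)` and elements `g_1, …, g_p` of `M`, the `K`-subspace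
`V g_1 + ⋯ + V g_p` of `M`. -/
def sumSMul (V : Submodule K (WeylAlgebra K n)) (g : Fin p → M) : Submodule K M :=
  ⨆ i, V.map ((LinearMap.toSpanSingleton (WeylAlgebra K n) M (g i)).restrictScalars K)

/-- `ψ` is the Bernstein polynomial of the system `g`: `ψ(r) = dim_K (∑ W_r g_i)` for all
sufficiently large integers `r` (these spaces are always finite-dimensional). -/
def IsBernsteinPolynomial (g : Fin p → M) (ψ : Polynomial ℚ) : Prop :=
  ∃ r₀ : ℤ, ∀ r : ℤ, r₀ ≤ r → ψ.eval (r : ℚ) = (Module.finrank K (sumSMul (W K n r) g) : ℚ)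

/-- `φ` is the characteristic polynomial of the system `g`: `φ(r, s) = dim_K (∑ W_{rs} g_i)` for
all sufficiently large integers `r` and `s` (these spaces are always finite-dimensional). -/
def IsCharacteristicPolynomial (g : Fin p → M) (φ : MvPolynomial (Fin 2) ℚ) : Prop :=
  ∃ r₀ s₀ : ℤ, ∀ r s : ℤ, r₀ ≤ r → s₀ ≤ s →
    MvPolynomial.eval ![(r : ℚ), (s : ℚ)] φ = (Module.finrank K (sumSMul (W₂ K n r s) g) : ℚ)

end Modules

/-- `M` belongs to the Bernstein class `B_n`: it is a finitely generated `A_n(K)`-module of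
Bernstein dimension `n`, i.e. it has a Bernstein polynomial of degree `n` with respect to a finite
system of generators. (For nonzero `M` the degree does not depend on the system.) -/
def InBernsteinClass (K : Type*) [Field K] (n : ℕ) (M : Type*) [AddCommGroup M] [Module K M]
    [Module (WeylAlgebra K n) M] [IsScalarTower K (WeylAlgebra K n) M] : Prop :=
  ∃ (p : ℕ) (g : Fin p → M) (ψ : Polynomial ℚ),
    Submodule.span (WeylAlgebra K n) (Set.range g) = ⊤ ∧
      IsBernsteinPolynomial (K := K) (n := n) g ψ ∧ ψ.degree = n

end WeylAlgebra

end

/-!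
The spaces `W_r g_1 + ⋯ + W_r g_p` and `W_{rs} g_1 + ⋯ + W_{rs} g_p` are spanned by the vectors
`x^α ∂^β g_i` of bounded degree, respectively bidegree. Applying `x_k` or `∂_k` to such a vector
raises one of its exponents by one, up to a combination of vectors `x^α' ∂^β' g_i` with `α' ≤ α` and
`β' ≤ β`. No other property of the module is needed for the two polynomials, which are therefore
treated together for an arbitrary multigrading of the exponents
(`eventuallyPolynomial_finrank_span`). Order the vectors lexicographically. The dimension of the
space of multidegree at most `d` is the number of vectors that are not combinations of their
predecessors within that space (`finrank_span_eq_card_standard`). Recording such a vector by its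
exponent together with the slack between its degree and `d`, these standard vectors become the
points of degree `d` in a lower set of exponents. A lower set is a finite disjoint union of
orthants (`IsLowerSet.orthant_induction`), and the points of degree `d` in an orthant are counted by
a product of binomial coefficients, a polynomial for large `d`.

The inequalities `ψ(r) ≤ φ(r, r) ≤ ψ(2r)` come from `W_r ⊆ W_{rr} ⊆ W_{2r}`; they show that `ψ` and
`φ(t, t)` have the same degree. It is the total degree of `φ` because the values of `φ` are
nonnegative and monotone: on every line through the origin with positive direction, `φ` is bounded
by its values on the diagonal (`MvPolynomial.natDegree_alongLine_one_eq_totalDegree`).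

The bound `deg ψ ≤ 2n` follows from counting monomials. The bound `n ≤ deg ψ` is Bernstein's
inequality: an operator of order at most `r` that annihilates `W_r g_1 + ⋯ + W_r g_p` is zero
(`WeylAlgebra.eq_zero_of_smul_sumSMul_eq_zero`), hence `W_r` embeds into the linear maps
from that space to `W_{2r} g_1 + ⋯ + W_{2r} g_p`, while the dimension of `W_r` grows
like `r^(2n)` by the linear independence of the monomials. Finally, the filtrations defined by two
systems of generators are comparable up to a shift, so that the degree of `ψ` does not depend on
the system.
-/

/-! ### Lower sets of exponents -/

open Finset in
/-- The sum of the coordinates of `a` in each block of the partition of the variables given by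
`w`. -/
def fiberSum {σ ι : Type*} [Fintype σ] [DecidableEq ι] (w : σ → ι) (a : σ → ℕ) : ι → ℕ :=
  fun j => ∑ i with w i = j, a i

/-- The translated coordinate orthant with corner `c` whose coordinates in `S` are frozen. -/
def orthant {σ : Type*} (c : σ → ℕ) (S : Finset σ) : Set (σ → ℕ) :=
  {a | c ≤ a ∧ ∀ i ∈ S, a i = c i}

/-- Exponents are built up from zero by raising one coordinate at a time. -/
theorem pi_nat_induction {κ : Type*} [Fintype κ] [DecidableEq κ] {P : (κ → ℕ) → Prop} (zero : P 0)
    (step : ∀ a k, P a → P (a + Pi.single k 1)) (a : κ → ℕ) : P a := by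
  induction h : ∑ k, a k generalizing a with
  | zero =>
    have : a = 0 := by
      funext k
      simpa using (Finset.sum_eq_zero_iff.1 h) k (Finset.mem_univ k)
    exact this ▸ zero
  | succ m ih =>
    obtain ⟨k, hk⟩ : ∃ k, a k ≠ 0 := by
      by_contra! hc
      simp [hc] at h
    have hle : Pi.single k 1 ≤ a := by
      intro l
      rcases eq_or_ne l k with rfl | hl
      · simpa using Nat.one_le_iff_ne_zero.2 hk
      · simp [hl]
    rw [← tsub_add_cancel_of_le hle]
    refine step _ _ (ih _ ?_)
    have : ∑ l, a l = ∑ l, (a - Pi.single k 1 : κ → ℕ) l + ∑ l, (Pi.single k 1 : κ → ℕ) l := by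
      rw [← Finset.sum_add_distrib]
      exact Finset.sum_congr rfl fun l _ => (Nat.sub_add_cancel (hle l)).symm
    rw [Finset.sum_pi_single' k 1 Finset.univ, if_pos (Finset.mem_univ k)] at this
    omega

/-- Inside an orthant, a lower set that misses a point `b` of the orthant lies below `b` in some
coordinate, so that it can be cut off along that coordinate; repeating this writes every lower set
as a finite disjoint union of orthants. -/
theorem IsLowerSet.orthant_induction {σ : Type*} [Fintype σ] [DecidableEq σ]
    {P : Set (σ → ℕ) → Prop} (empty : P ∅) (orth : ∀ c S, P (orthant c S))
    (union : ∀ D E, Disjoint D E → P D → P E → P (D ∪ E)) {D : Set (σ → ℕ)} (hD : IsLowerSet D) :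
    P D := by
  suffices H : ∀ (m : ℕ) (c : σ → ℕ) (S : Finset σ), Sᶜ.card = m → P (orthant c S ∩ D) by
    have := H _ 0 ∅ rfl
    rwa [show orthant (0 : σ → ℕ) ∅ = Set.univ by ext; simp [orthant],
      Set.univ_inter] at this
  intro m
  induction m using Nat.strong_induction_on with
  | _ m ih =>
    intro c S hS
    by_cases hsub : orthant c S ⊆ D
    · rw [Set.inter_eq_left.2 hsub]
      exact orth c S
    obtain ⟨b, hb, hbD⟩ := Set.not_subset.1 hsub
    induction hs : ∑ i, (b i - c i) using Nat.strong_induction_on generalizing c with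
    | _ s ihs =>
      by_cases hbc : b ≤ c
      · have : orthant c S ∩ D = ∅ := by
          ext a
          simp only [Set.mem_inter_iff, Set.mem_empty_iff_false, iff_false, not_and]
          exact fun ha haD => hbD (hD (hbc.trans ha.1) haD)
        rw [this]
        exact empty
      obtain ⟨i, hi⟩ : ∃ i, c i < b i := by simpa [Pi.le_def] using hbc
      have hiS : i ∉ S := fun h => hi.ne' (hb.2 i h)
      have hsplit : orthant c S ∩ D =
          (orthant c (insert i S) ∩ D) ∪ (orthant (c + Pi.single i 1) S ∩ D) := by
        rw [← Set.union_inter_distrib_right]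
        congr 1
        ext a
        constructor
        · rintro ⟨h1, h2⟩
          rcases (h1 i).eq_or_lt with h | h
          · exact Or.inl ⟨h1, by simpa [h] using h2⟩
          · refine Or.inr ⟨fun l => ?_, fun l hl => ?_⟩
            · rcases eq_or_ne l i with rfl | hl
              · simpa using h
              · simpa [hl] using h1 l
            · have : l ≠ i := fun h => hiS (h ▸ hl)
              simpa [this] using h2 l hl
        · rintro (⟨h1, h2⟩ | ⟨h1, h2⟩)
          · exact ⟨h1, fun l hl => h2 l (Finset.mem_insert_of_mem hl)⟩
          · refine ⟨le_trans (by simp) h1, fun l hl => ?_⟩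
            have : l ≠ i := fun h => hiS (h ▸ hl)
            simpa [this] using h2 l hl
      rw [hsplit]
      refine union _ _ ?_ ?_ ?_
      · refine Set.disjoint_left.2 ?_
        rintro a ⟨⟨-, h1⟩, -⟩ ⟨⟨h2, -⟩, -⟩
        have h3 := h1 i (Finset.mem_insert_self _ _)
        have h4 := h2 i
        simp [h3] at h4
      · refine ih _ ?_ c (insert i S) rfl
        rw [← hS]
        refine Finset.card_lt_card ?_
        rw [Finset.compl_ssubset_compl]
        exact Finset.ssubset_insert hiS
      · have hb' : b ∈ orthant (c + Pi.single i 1) S := by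
          refine ⟨fun l => ?_, fun l hl => ?_⟩
          · rcases eq_or_ne l i with rfl | hl
            · simpa using hi
            · simpa [hl] using hb.1 l
          · have : l ≠ i := fun h => hiS (h ▸ hl)
            simpa [this] using hb.2 l hl
        refine ihs _ ?_ _ (fun h => hbD (h hb')) hb' rfl
        rw [← hs]
        refine Finset.sum_lt_sum (fun l _ => ?_) ⟨i, Finset.mem_univ _, ?_⟩
        · exact Nat.sub_le_sub_left (by simp) _
        · simp
          omega

/-! ### Counting exponents by degree -/

/-- The function `f` of several natural numbers agrees with a polynomial wherever all its arguments
are large. -/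
def EventuallyPolynomial {ι : Type*} (f : (ι → ℕ) → ℕ) : Prop :=
  ∃ (P : MvPolynomial ι ℚ) (d₀ : ι → ℕ), ∀ d, d₀ ≤ d →
    MvPolynomial.eval (fun j => (d j : ℚ)) P = f d

namespace EventuallyPolynomial

variable {ι : Type*}

theorem zero : EventuallyPolynomial fun _ : ι → ℕ => 0 := ⟨0, 0, by simp⟩

theorem add {f g : (ι → ℕ) → ℕ} (hf : EventuallyPolynomial f) (hg : EventuallyPolynomial g) :
    EventuallyPolynomial fun d => f d + g d := by
  obtain ⟨P, d₁, h₁⟩ := hf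
  obtain ⟨Q, d₂, h₂⟩ := hg
  refine ⟨P + Q, d₁ ⊔ d₂, fun d hd => ?_⟩
  simp [h₁ d (le_sup_left.trans hd), h₂ d (le_sup_right.trans hd)]

theorem sum {τ : Type*} (s : Finset τ) {f : τ → (ι → ℕ) → ℕ}
    (hf : ∀ i ∈ s, EventuallyPolynomial (f i)) : EventuallyPolynomial fun d => ∑ i ∈ s, f i d := by
  classical
  induction s using Finset.induction_on with
  | empty => simpa using zero
  | insert a s ha ih =>
    simp only [Finset.sum_insert ha]
    exact (hf a (by simp)).add (ih fun i hi => hf i (by simp [hi]))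

end EventuallyPolynomial

/-- A multiset coefficient is a polynomial function of its second argument, except that
`Nat.multichoose 0` is `1` at `0`, where the polynomial is zero. -/
theorem exists_polynomial_multichoose (m c : ℕ) :
    ∃ (P : Polynomial ℚ) (l₀ : ℕ), ∀ l, l₀ ≤ l → P.eval (l : ℚ) = (m.multichoose (l - c) : ℚ) := by
  cases m with
  | zero =>
    refine ⟨0, c + 1, fun l hl => ?_⟩
    obtain ⟨k, hk⟩ : ∃ k, l - c = k + 1 := ⟨l - c - 1, by omega⟩
    simp [hk]
  | succ m =>
    refine ⟨Polynomial.preHilbertPoly ℚ m c, c, fun l hl => ?_⟩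
    rw [Polynomial.preHilbertPoly_eq_choose_sub_add ℚ m hl, Nat.multichoose_eq]
    norm_cast
    rw [show m + 1 + (l - c) - 1 = l - c + m by omega, Nat.choose_symm_add]

section Counting

variable {σ ι : Type*} [Fintype σ] [DecidableEq ι] (w : σ → ι)

theorem le_fiberSum (a : σ → ℕ) (i : σ) : a i ≤ fiberSum w a (w i) :=
  Finset.single_le_sum (f := a) (fun _ _ => Nat.zero_le _) (by simp)

theorem fiberSum_mono {a b : σ → ℕ} (h : a ≤ b) : fiberSum w a ≤ fiberSum w b :=
  fun _ => Finset.sum_le_sum fun i _ => h i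

theorem fiberSum_add (a b : σ → ℕ) : fiberSum w (a + b) = fiberSum w a + fiberSum w b := by
  funext j
  simp [fiberSum, Finset.sum_add_distrib]

theorem fiberSum_single [DecidableEq σ] (k : σ) :
    fiberSum w (Pi.single k 1) = Pi.single (w k) 1 := by
  funext j
  simp [fiberSum, Pi.single_apply, eq_comm]

theorem finite_fiberSum_le (d : ι → ℕ) : {a | fiberSum w a ≤ d}.Finite := by
  classical
  exact (Set.finite_Icc 0 fun i => d (w i)).subset fun a ha =>
    ⟨zero_le, fun i => (le_fiberSum w a i).trans (ha (w i))⟩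

variable [Fintype ι]

/-- The points of degree `d` in an orthant are counted by a product of multiset coefficients, one
for each block. -/
theorem eventuallyPolynomial_orthant [DecidableEq σ] (c : σ → ℕ) (S : Finset σ) :
    EventuallyPolynomial fun d => {a | a ∈ orthant c S ∧ fiberSum w a = d}.ncard := by
  let T : ι → Finset σ := fun j => {i | w i = j ∧ i ∉ S}
  have key : ∀ d, fiberSum w c ≤ d → {a | a ∈ orthant c S ∧ fiberSum w a = d}.ncard =
      ∏ j, (T j).card.multichoose (d j - fiberSum w c j) := by
    intro d hd
    -- A point of the orthant is the corner plus, in each block, a distribution of the remaining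
    -- degree over the coordinates that are not frozen.
    let B : Finset (ι → σ →₀ ℕ) :=
      Fintype.piFinset fun j => (T j).finsuppAntidiag (d j - fiberSum w c j)
    let φ : (ι → σ →₀ ℕ) → σ → ℕ := fun F i => c i + F (w i) i
    have hB : ∀ F, F ∈ B ↔
        ∀ j, (T j).sum (F j) = d j - fiberSum w c j ∧ (F j).support ⊆ T j := fun F => by
      simp [B, Fintype.mem_piFinset, Finset.mem_finsuppAntidiag]
    have hT : ∀ (F : ι → σ →₀ ℕ), (∀ j, (F j).support ⊆ T j) → ∀ j,
        ∑ i with w i = j, F (w i) i = (T j).sum (F j) := fun F hF j => by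
      have h1 : ∑ i with w i = j, F (w i) i = ∑ i with w i = j, F j i :=
        Finset.sum_congr rfl fun i hi => by rw [(Finset.mem_filter.1 hi).2]
      rw [h1]
      refine (Finset.sum_subset (fun i hi => ?_) fun i _ hi => ?_).symm
      · simp only [T, Finset.mem_filter] at hi ⊢
        exact ⟨hi.1, hi.2.1⟩
      · exact Finsupp.notMem_support_iff.1 fun h => hi (hF j h)
    have himg : {a | a ∈ orthant c S ∧ fiberSum w a = d} = φ '' B := by
      ext a
      constructor
      · rintro ⟨⟨h1, h2⟩, h3⟩
        let F : ι → σ →₀ ℕ := fun j =>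
          Finsupp.onFinset (T j) (fun i => if i ∈ T j then a i - c i else 0)
            (fun i hi => by by_contra h; simp [h] at hi)
        have hφ : φ F = a := by
          funext i
          by_cases hi : i ∈ S
          · simp [φ, F, T, hi, h2 i hi]
          · simpa [φ, F, T, hi] using Nat.add_sub_cancel' (h1 i)
        have hsupp : ∀ j, (F j).support ⊆ T j := fun j => Finsupp.support_onFinset_subset
        refine ⟨F, (hB F).2 fun j => ⟨?_, hsupp j⟩, hφ⟩
        have := congrFun h3 j
        rw [← hφ] at this
        simp only [fiberSum, φ, Finset.sum_add_distrib] at this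
        rw [hT F hsupp j] at this
        simp only [fiberSum]
        omega
      · rintro ⟨F, hF, rfl⟩
        have hF := (hB F).1 hF
        refine ⟨⟨fun i => Nat.le_add_right _ _, fun i hi => ?_⟩, ?_⟩
        · have : i ∉ (F (w i)).support := fun h => by
            have := (hF (w i)).2 h
            simp [T, hi] at this
          simpa [φ] using this
        · funext j
          simp only [fiberSum, φ, Finset.sum_add_distrib]
          rw [hT F (fun j => (hF j).2) j, (hF j).1]
          have := hd j
          simp only [fiberSum] at this ⊢
          omega
    have hinj : Set.InjOn φ B := by
      intro F hF G hG h
      have hF := (hB F).1 hF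
      have hG := (hB G).1 hG
      funext j
      ext i
      by_cases hi : w i = j
      · subst hi
        have := congrFun h i
        simpa [φ] using this
      · have h1 : i ∉ (F j).support := fun h => by
          have := (hF j).2 h
          simp [T, hi] at this
        have h2 : i ∉ (G j).support := fun h => by
          have := (hG j).2 h
          simp [T, hi] at this
        rw [Finsupp.notMem_support_iff.1 h1, Finsupp.notMem_support_iff.1 h2]
    rw [himg, hinj.ncard_image, Set.ncard_coe_finset, Fintype.card_piFinset]
    simp [Finset.card_finsuppAntidiag_nat_eq_multichoose]
  choose P l hP using fun j => exists_polynomial_multichoose (T j).card (fiberSum w c j)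
  refine ⟨∏ j, Polynomial.aeval (MvPolynomial.X j) (P j), fiberSum w c ⊔ l, fun d hd => ?_⟩
  simp only [key d (le_sup_left.trans hd)]
  push_cast
  rw [map_prod]
  refine Finset.prod_congr rfl fun j _ => ?_
  rw [← hP j (d j) (le_trans le_sup_right (hd j)), ← MvPolynomial.coe_aeval_eq_eval,
    ← AlgHom.toRingHom_eq_coe]
  change MvPolynomial.aeval _ (Polynomial.aeval _ _) = _
  rw [← Polynomial.aeval_algHom_apply]
  simp [Polynomial.coe_aeval_eq_eval]

/-- The multigraded Hilbert function of a lower set of exponents is eventually polynomial. -/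
theorem IsLowerSet.eventuallyPolynomial_ncard {D : Set (σ → ℕ)} (hD : IsLowerSet D) :
    EventuallyPolynomial fun d => {a | a ∈ D ∧ fiberSum w a = d}.ncard := by
  classical
  refine hD.orthant_induction (P := fun D => EventuallyPolynomial fun d =>
    {a | a ∈ D ∧ fiberSum w a = d}.ncard) ?_ (eventuallyPolynomial_orthant w) ?_
  · simpa using EventuallyPolynomial.zero
  · intro D E hDE h1 h2
    convert h1.add h2 using 2 with d
    have hfin : ∀ D : Set (σ → ℕ), {a | a ∈ D ∧ fiberSum w a = d}.Finite := fun D =>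
      (finite_fiberSum_le w d).subset fun a ha => ha.2.le
    rw [← Set.ncard_union_eq ?_ (hfin _) (hfin _)]
    · congr 1
      ext a
      simp only [Set.mem_ofPred_eq, Set.mem_union]
      tauto
    · exact Set.disjoint_left.2 fun a h1 h2 => Set.disjoint_left.1 hDE h1.1 h2.1

end Counting

/-! ### Dimension of a multifiltered space -/

section Standard

variable {K M I L : Type*} [Field K] [AddCommGroup M] [Module K M] [LinearOrder L]

theorem finrank_span_insert {s : Set M} (hs : s.Finite) (x : M)
    [Decidable (x ∈ Submodule.span K s)] :
    Module.finrank K (Submodule.span K (insert x s)) =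
      Module.finrank K (Submodule.span K s) + if x ∈ Submodule.span K s then 0 else 1 := by
  have := FiniteDimensional.span_of_finite K hs
  split_ifs with hx
  · rw [Submodule.span_insert_eq_span hx, add_zero]
  · have hx0 : x ≠ 0 := fun h => hx (h ▸ Submodule.zero_mem _)
    have hdis : Disjoint (Submodule.span K {x}) (Submodule.span K s) := by
      rwa [disjoint_comm, Submodule.disjoint_span_singleton' hx0]
    have := Submodule.finrank_sup_add_finrank_inf_eq (Submodule.span K {x}) (Submodule.span K s)
    rw [hdis.eq_bot, finrank_bot, finrank_span_singleton hx0, ← Submodule.span_insert] at this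
    omega

/-- In a finite family of vectors, the vectors outside the span of their predecessors form a
basis of the span of the family. -/
theorem finrank_span_eq_card_standard {rk : I → L} (hrk : Function.Injective rk) (v : I → M)
    (T : Finset I) : Module.finrank K (Submodule.span K (v '' T)) =
      {i | i ∈ T ∧ v i ∉ Submodule.span K (v '' {j | j ∈ T ∧ rk j < rk i})}.ncard := by
  classical
  induction T using Finset.induction_on_max_value rk with
  | empty =>
    rw [Finset.coe_empty, Set.image_empty, Submodule.span_empty, finrank_bot]
    simp
  | insert a s ha hmax ih =>
    have hlt : ∀ i ∈ s, rk i < rk a := fun i hi =>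
      (hmax i hi).lt_of_ne fun h => ha (hrk h ▸ hi)
    have hpre : ∀ i ∈ s, {j | j ∈ insert a s ∧ rk j < rk i} = {j | j ∈ s ∧ rk j < rk i} := by
      intro i hi
      ext j
      simp only [Finset.mem_insert, Set.mem_ofPred_eq]
      constructor
      · rintro ⟨rfl | hj, h⟩
        · exact absurd h (hlt i hi).not_gt
        · exact ⟨hj, h⟩
      · exact fun h => ⟨Or.inr h.1, h.2⟩
    have hprea : {j | j ∈ insert a s ∧ rk j < rk a} = (s : Set I) := by
      ext j
      simp only [Finset.mem_insert, Set.mem_ofPred_eq, Finset.mem_coe]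
      constructor
      · rintro ⟨rfl | hj, h⟩
        · exact absurd h (lt_irrefl _)
        · exact hj
      · exact fun h => ⟨Or.inr h, hlt j h⟩
    have hfin : {i | i ∈ s ∧
        v i ∉ Submodule.span K (v '' {j | j ∈ s ∧ rk j < rk i})}.Finite :=
      s.finite_toSet.subset fun i hi => hi.1
    have hset : {i | i ∈ insert a s ∧
        v i ∉ Submodule.span K (v '' {j | j ∈ insert a s ∧ rk j < rk i})} =
        {i | i ∈ s ∧ v i ∉ Submodule.span K (v '' {j | j ∈ s ∧ rk j < rk i})} ∪
          {i | i = a ∧ v a ∉ Submodule.span K (v '' s)} := by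
      ext i
      by_cases hi : i ∈ s
      · have : i ≠ a := fun h => ha (h ▸ hi)
        simp only [Set.mem_ofPred_eq, Set.mem_union, hpre i hi]
        simp [hi, this]
      · by_cases hia : i = a
        · subst hia
          simp only [Set.mem_ofPred_eq, Set.mem_union, hprea]
          simp [hi]
        · simp [hi, hia]
    have hdisj : Disjoint {i | i ∈ s ∧ v i ∉ Submodule.span K (v '' {j | j ∈ s ∧ rk j < rk i})}
        {i | i = a ∧ v a ∉ Submodule.span K (v '' s)} :=
      Set.disjoint_left.2 fun i h1 h2 => ha (h2.1 ▸ h1.1)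
    rw [hset, Set.ncard_union_eq hdisj hfin ((Set.finite_singleton a).subset fun i hi => hi.1),
      ← ih, Finset.coe_insert, Set.image_insert_eq,
      finrank_span_insert (s.finite_toSet.image v)]
    congr 1
    split_ifs with h
    · simp [h]
    · simp [h]

end Standard

section Hilbert

variable {K M κ ι : Type*} [Field K] [AddCommGroup M] [Module K M] [Fintype κ] [DecidableEq κ]
  [Fintype ι] [DecidableEq ι] {p : ℕ}

open Submodule in
/-- Let `v` be a finite number of systems of vectors indexed by exponents, and suppose that raising
one exponent of a vector is the effect of a linear operator, up to a combination of vectors with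
smaller exponents. Then the dimension of the space spanned by the vectors of multidegree at most
`d` is eventually polynomial in `d`. Indeed, order all the vectors lexicographically; the pairs
`(a, d - deg a)` such that `v (i, a)` is not a combination of its predecessors of degree at most
`d` form a lower set, and their number in degree `d` is the dimension. -/
theorem eventuallyPolynomial_finrank_span (w : κ → ι) (v : Fin p × (κ → ℕ) → M)
    (X : κ → M →ₗ[K] M)
    (hX : ∀ k i a, X k (v (i, a)) - v (i, a + Pi.single k 1) ∈
      span K ((fun b => v (i, b)) '' {b | b ≤ a})) :
    EventuallyPolynomial fun d => Module.finrank K (span K (v '' {q | fiberSum w q.2 ≤ d})) := by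
  classical
  -- Numbering the variables makes the lexicographic order on exponents available.
  let e := Fintype.equivFin κ
  let rk : Fin p × (κ → ℕ) → Fin p ×ₗ Lex (Fin (Fintype.card κ) → ℕ) :=
    fun q => toLex (q.1, toLex (q.2 ∘ e.symm))
  have hrk : Function.Injective rk := by
    rintro ⟨i, a⟩ ⟨j, b⟩ h
    simp only [rk, EmbeddingLike.apply_eq_iff_eq, Prod.mk.injEq] at h
    obtain ⟨rfl, h⟩ := h
    rw [e.symm.surjective.injective_comp_right h]
  have hrk_lt : ∀ {i j : Fin p} {a b : κ → ℕ}, rk (i, a) < rk (j, b) ↔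
      i < j ∨ i = j ∧ toLex (a ∘ e.symm) < toLex (b ∘ e.symm) :=
    fun {i j a b} => Prod.Lex.toLex_lt_toLex
  have hrk_add : ∀ {i j : Fin p} {a b : κ → ℕ} (c : κ → ℕ), rk (i, a) < rk (j, b) →
      rk (i, a + c) < rk (j, b + c) := by
    intro i j a b c h
    rw [hrk_lt] at h ⊢
    refine h.imp id fun h => ⟨h.1, ?_⟩
    exact add_lt_add_left h.2 (toLex (c ∘ e.symm))
  have hrk_le : ∀ {i : Fin p} {a b : κ → ℕ}, a ≤ b → rk (i, a) ≤ rk (i, b) := by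
    intro i a b h
    have h' : toLex (a ∘ e.symm) ≤ toLex (b ∘ e.symm) := Pi.toLex_monotone fun l => h (e.symm l)
    exact Prod.Lex.toLex_le_toLex.2 (Or.inr ⟨rfl, h'⟩)
  have hrk_single : ∀ (i : Fin p) (a : κ → ℕ) (k : κ), rk (i, a) < rk (i, a + Pi.single k 1) := by
    intro i a k
    refine lt_of_le_of_ne (hrk_le (by simp)) fun h => ?_
    have := (Prod.mk.inj (hrk h)).2
    simp at this
  -- The span of the predecessors of the vector `v q` within multidegree `d`; the vector is standard
  -- in multidegree `d` if it lies outside.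
  let pre : (ι → ℕ) → Fin p × (κ → ℕ) → Submodule K M := fun d q =>
    span K (v '' {q' | fiberSum w q'.2 ≤ d ∧ rk q' < rk q})
  have hmono : ∀ {d d' q}, d ≤ d' → v q ∈ pre d q → v q ∈ pre d' q := fun h hq =>
    by
    refine span_mono (Set.image_mono ?_) hq
    exact fun q' hq' => ⟨hq'.1.trans h, hq'.2⟩
  have herr : ∀ {k i a d q}, fiberSum w a ≤ d → rk (i, a + Pi.single k 1) ≤ rk q →
      X k (v (i, a)) - v (i, a + Pi.single k 1) ∈ pre d q := by
    intro k i a d q hd hq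
    refine (span_le.2 ?_) (hX k i a)
    rintro _ ⟨b, hb, rfl⟩
    exact subset_span ⟨(i, b), ⟨(fiberSum_mono w hb).trans hd,
      (hrk_le hb).trans_lt ((hrk_single i a k).trans_le hq)⟩, rfl⟩
  -- Raising an exponent keeps a vector nonstandard, provided that the degree bound is raised too.
  have hstep : ∀ {k i a d}, fiberSum w a ≤ d → v (i, a) ∈ pre d (i, a) →
      v (i, a + Pi.single k 1) ∈ pre (d + Pi.single (w k) 1) (i, a + Pi.single k 1) := by
    intro k i a d hd hv
    have h1 : (pre d (i, a)).map (X k) ≤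
        pre (d + Pi.single (w k) 1) (i, a + Pi.single k 1) := by
      rw [map_span, span_le]
      rintro _ ⟨_, ⟨⟨j, b⟩, ⟨hb, hlt⟩, rfl⟩, rfl⟩
      have h2 := hrk_add (Pi.single k 1) hlt
      rw [← sub_add_cancel (X k (v (j, b))) (v (j, b + Pi.single k 1))]
      refine add_mem (herr (le_add_right hb) h2.le)
        (subset_span ⟨(j, b + Pi.single k 1), ⟨?_, h2⟩, rfl⟩)
      rw [fiberSum_add, fiberSum_single]
      exact add_le_add_left hb _
    have h3 := h1 (mem_map_of_mem hv)
    rw [← sub_sub_cancel (X k (v (i, a))) (v (i, a + Pi.single k 1))]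
    exact sub_mem h3 (herr (le_add_right hd) le_rfl)
  -- One slack variable in each block turns the condition `deg a ≤ d` into an equality of degrees.
  let w' : κ ⊕ ι → ι := Sum.elim w id
  let D : Fin p → Set (κ ⊕ ι → ℕ) := fun i =>
    {a | v (i, a ∘ Sum.inl) ∉ pre (fiberSum w (a ∘ Sum.inl) + a ∘ Sum.inr) (i, a ∘ Sum.inl)}
  have hD : ∀ i, IsLowerSet (D i) := by
    intro i a b hba ha
    have key : ∀ c : κ → ℕ, v (i, b ∘ Sum.inl) ∈
        pre (fiberSum w (b ∘ Sum.inl) + b ∘ Sum.inr) (i, b ∘ Sum.inl) →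
        v (i, b ∘ Sum.inl + c) ∈
        pre (fiberSum w (b ∘ Sum.inl + c) + b ∘ Sum.inr) (i, b ∘ Sum.inl + c) := by
      intro c hb
      induction c using pi_nat_induction with
      | zero => simpa using hb
      | step c k ih =>
        have := hstep (k := k) (le_add_right le_rfl) ih
        rwa [add_right_comm, ← fiberSum_single, ← fiberSum_add, add_assoc] at this
    intro hb
    refine ha ?_
    have h1 := key (a ∘ Sum.inl - b ∘ Sum.inl) hb
    have h2 : b ∘ Sum.inl + (a ∘ Sum.inl - b ∘ Sum.inl) = a ∘ Sum.inl :=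
      add_tsub_cancel_of_le fun k => hba (Sum.inl k)
    rw [h2] at h1
    exact hmono (add_le_add_right (fun j => hba (Sum.inr j)) _) h1
  have hsum : ∀ a : κ ⊕ ι → ℕ, fiberSum w' a = fiberSum w (a ∘ Sum.inl) + a ∘ Sum.inr := by
    intro a
    funext j
    simp only [fiberSum, Finset.sum_filter, w', Fintype.sum_sum_type, Sum.elim_inl, Sum.elim_inr,
      id, Pi.add_apply, Function.comp_apply]
    exact congrArg _ ((Finset.sum_ite_eq' Finset.univ j _).trans (if_pos (Finset.mem_univ j)))
  have hfin : ∀ d : ι → ℕ, {q : Fin p × (κ → ℕ) | fiberSum w q.2 ≤ d}.Finite := fun d =>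
    (Set.finite_univ.prod (finite_fiberSum_le w d)).subset fun q hq => ⟨Set.mem_univ _, hq⟩
  convert EventuallyPolynomial.sum Finset.univ
    fun i _ => (hD i).eventuallyPolynomial_ncard w' using 2 with d
  have h1 := finrank_span_eq_card_standard (K := K) hrk v (hfin d).toFinset
  rw [Set.Finite.coe_toFinset] at h1
  simp only [Set.Finite.mem_toFinset] at h1
  rw [h1]
  have hfin' : {q | fiberSum w q.2 ≤ d ∧ v q ∉ pre d q}.Finite :=
    (hfin d).subset fun q hq => hq.1
  change {q | fiberSum w q.2 ≤ d ∧ v q ∉ pre d q}.ncard = _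
  rw [Set.ncard_eq_toFinset_card _ hfin',
    Finset.card_eq_sum_card_fiberwise (f := Prod.fst) (t := Finset.univ) (by simp)]
  refine Finset.sum_congr rfl fun i _ => ?_
  rw [← Set.ncard_coe_finset]
  refine (Set.ncard_congr (fun a _ => (i, a ∘ Sum.inl)) ?_ ?_ ?_).symm
  · rintro a ⟨h1, h2⟩
    rw [hsum] at h2
    simp only [Finset.coe_filter, Set.Finite.mem_toFinset, Set.mem_ofPred_eq, and_true]
    refine ⟨h2 ▸ le_add_right le_rfl, ?_⟩
    rwa [← h2]
  · rintro a b ⟨-, ha⟩ ⟨-, hb⟩ h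
    have h := (Prod.mk.inj h).2
    rw [hsum] at ha hb
    rw [h, ← hb] at ha
    have h' := add_left_cancel ha
    funext x
    cases x with
    | inl k => exact congrFun h k
    | inr j => exact congrFun h' j
  · rintro ⟨i', a⟩ hq
    simp only [Finset.coe_filter, Set.Finite.mem_toFinset, Set.mem_ofPred_eq] at hq
    obtain ⟨⟨h2, h3⟩, rfl⟩ := hq
    have h4 : fiberSum w a + (d - fiberSum w a) = d := add_tsub_cancel_of_le h2
    have h5 : (Sum.elim a (d - fiberSum w a) : κ ⊕ ι → ℕ) ∘ Sum.inl = a := Sum.elim_comp_inl _ _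
    have h6 : (Sum.elim a (d - fiberSum w a) : κ ⊕ ι → ℕ) ∘ Sum.inr = d - fiberSum w a :=
      Sum.elim_comp_inr _ _
    refine ⟨Sum.elim a (d - fiberSum w a), ⟨?_, ?_⟩, by rw [h5]⟩
    · change v (i', Sum.elim a (d - fiberSum w a) ∘ Sum.inl) ∉ pre _ _
      rw [h5, h6, h4]
      exact h3
    · rw [hsum, h5, h6, h4]

end Hilbert

/-! ### Multiplication in the Weyl algebra -/

section OrderedProduct

variable {K R : Type*} [CommSemiring K] [Semiring R] [Algebra K R] {n : ℕ}

theorem Pi.sub_single_add_single {κ : Type*} [DecidableEq κ] {β : κ → ℕ} {k : κ} (h : β k ≠ 0) :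
    β - Pi.single k 1 + Pi.single k 1 = β := by
  refine tsub_add_cancel_of_le fun l => ?_
  rcases eq_or_ne l k with rfl | hl
  · simpa using Nat.one_le_iff_ne_zero.2 h
  · simp [hl]

theorem Pi.add_single_sub_single {κ : Type*} [DecidableEq κ] (β : κ → ℕ) {j k : κ} (h : j ≠ k) :
    β + Pi.single j 1 - Pi.single k 1 = β - Pi.single k 1 + Pi.single j 1 := by
  funext i
  simp only [Pi.add_apply, Pi.sub_apply, Pi.single_apply]
  split_ifs <;> grind

theorem mul_prod_ofFn_pow {y : Fin n → R} (hy : ∀ i j, Commute (y i) (y j)) (k : Fin n)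
    (β : Fin n → ℕ) : y k * (List.ofFn fun i => y i ^ β i).prod =
      (List.ofFn fun i => y i ^ (β + Pi.single k 1 : Fin n → ℕ) i).prod := by
  induction n with
  | zero => exact k.elim0
  | succ n ih =>
    simp only [List.ofFn_succ, List.prod_cons]
    cases k using Fin.cases with
    | zero => simp [← mul_assoc, ← pow_succ']
    | succ k =>
      rw [← mul_assoc, ((hy k.succ 0).pow_right _).eq, mul_assoc,
        ih (y := fun i => y i.succ) (fun i j => hy _ _)]
      simp [Pi.single_apply]

theorem commute_prod_ofFn_pow {y : Fin n → R} (hy : ∀ i j, Commute (y i) (y j)) (k : Fin n)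
    (β : Fin n → ℕ) : Commute (y k) (List.ofFn fun i => y i ^ β i).prod :=
  Commute.list_prod_right _ _ fun z hz => by
    obtain ⟨i, rfl⟩ := List.mem_ofFn.1 hz
    exact (hy k i).pow_right _

/-- The canonical commutation relation for an ordered product of powers. -/
theorem prod_ofFn_pow_mul {y : Fin n → R} (hy : ∀ i j, Commute (y i) (y j)) {z : R} {k : Fin n}
    (hz : ∀ j, y j * z = z * y j + if j = k then 1 else 0) (β : Fin n → ℕ) :
    (List.ofFn fun i => y i ^ β i).prod * z = z * (List.ofFn fun i => y i ^ β i).prod +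
      (β k : K) • (List.ofFn fun i => y i ^ (β - Pi.single k 1 : Fin n → ℕ) i).prod := by
  induction β using pi_nat_induction with
  | zero => simp
  | step β j ih =>
    rw [← mul_prod_ofFn_pow hy, mul_assoc, ih, mul_add, ← mul_assoc, hz, mul_smul_comm,
      mul_prod_ofFn_pow hy, add_mul, mul_assoc, add_assoc]
    congr 1
    split_ifs with h
    · subst h
      rw [add_tsub_cancel_right, one_mul, Pi.add_apply, Pi.single_eq_same, Nat.cast_add_one,
        add_smul, one_smul, add_comm]
      congr 1
      rcases Nat.eq_zero_or_pos (β j) with h0 | h0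
      · simp [h0]
      · rw [Pi.sub_single_add_single h0.ne']
    · rw [zero_mul, zero_add, Pi.add_apply, Pi.single_eq_of_ne (Ne.symm h), add_zero,
        Pi.add_single_sub_single _ h]

theorem mul_prod_ofFn_pow_eq_add {y : Fin n → R} (hy : ∀ i j, Commute (y i) (y j)) {z : R}
    {k : Fin n} (hz : ∀ j, z * y j = y j * z + if j = k then 1 else 0) (β : Fin n → ℕ) :
    z * (List.ofFn fun i => y i ^ β i).prod = (List.ofFn fun i => y i ^ β i).prod * z +
      (β k : K) • (List.ofFn fun i => y i ^ (β - Pi.single k 1 : Fin n → ℕ) i).prod := by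
  induction β using pi_nat_induction with
  | zero => simp
  | step β j ih =>
    rw [← mul_prod_ofFn_pow hy, ← mul_assoc, hz, add_mul, mul_assoc, ih, mul_add, mul_smul_comm,
      mul_prod_ofFn_pow hy, ← mul_assoc, add_assoc]
    congr 1
    split_ifs with h
    · subst h
      rw [add_tsub_cancel_right, one_mul, Pi.add_apply, Pi.single_eq_same, Nat.cast_add_one,
        add_smul, one_smul]
      congr 1
      rcases Nat.eq_zero_or_pos (β j) with h0 | h0
      · simp [h0]
      · rw [Pi.sub_single_add_single h0.ne']
    · rw [zero_mul, add_zero, Pi.add_apply, Pi.single_eq_of_ne (Ne.symm h), add_zero,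
        Pi.add_single_sub_single _ h]

end OrderedProduct

namespace WeylAlgebra

variable {K : Type*} [Field K] {n : ℕ}

theorem x_commute (i j : Fin n) : Commute (x K i) (x K j) :=
  Subtype.ext <| LinearMap.ext fun f => by
    change MvPolynomial.X i * (MvPolynomial.X j * f) = MvPolynomial.X j * (MvPolynomial.X i * f)
    ring

theorem d_commute (i j : Fin n) : Commute (d K i) (d K j) := by
  have h : ⁅(MvPolynomial.pderiv i : Derivation K (MvPolynomial (Fin n) K) _),
      (MvPolynomial.pderiv j : Derivation K (MvPolynomial (Fin n) K) _)⁆ = 0 := by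
    refine MvPolynomial.derivation_ext fun k => ?_
    rw [Derivation.commutator_apply]
    simp only [MvPolynomial.pderiv_X, Pi.single_apply]
    split_ifs <;> simp
  refine Subtype.ext <| LinearMap.ext fun f => ?_
  have := congrArg (fun D => D f) h
  rw [Derivation.commutator_apply] at this
  exact sub_eq_zero.1 this

theorem d_mul_x (j k : Fin n) : d K j * x K k = x K k * d K j + if j = k then 1 else 0 := by
  have hleib : ∀ f : MvPolynomial (Fin n) K, MvPolynomial.pderiv j (MvPolynomial.X k * f) =
      MvPolynomial.X k * MvPolynomial.pderiv j f +
        f * MvPolynomial.pderiv j (MvPolynomial.X k) := fun f => by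
    rw [Derivation.leibniz, smul_eq_mul, smul_eq_mul]
  by_cases h : j = k
  · rw [if_pos h]
    refine Subtype.ext <| LinearMap.ext fun f => ?_
    refine (hleib f).trans ?_
    rw [h, MvPolynomial.pderiv_X_self, mul_one]
    rfl
  · rw [if_neg h, add_zero]
    refine Subtype.ext <| LinearMap.ext fun f => ?_
    refine (hleib f).trans ?_
    rw [MvPolynomial.pderiv_X_of_ne (Ne.symm h), mul_zero, add_zero]
    rfl

theorem x_mul_monomial (k : Fin n) (α β : Fin n → ℕ) :
    x K k * monomial K α β = monomial K (α + Pi.single k 1) β := by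
  rw [monomial, ← mul_assoc, mul_prod_ofFn_pow x_commute, monomial]

theorem monomial_mul_d (k : Fin n) (α β : Fin n → ℕ) :
    monomial K α β * d K k = monomial K α (β + Pi.single k 1) := by
  rw [monomial, mul_assoc, ← (commute_prod_ofFn_pow d_commute k β).eq,
    mul_prod_ofFn_pow d_commute, monomial]

theorem d_mul_monomial (k : Fin n) (α β : Fin n → ℕ) :
    d K k * monomial K α β =
      monomial K α (β + Pi.single k 1) + (α k : K) • monomial K (α - Pi.single k 1) β := by
  rw [monomial, ← mul_assoc, mul_prod_ofFn_pow_eq_add (K := K) x_commute (k := k) (fun j => by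
    rw [d_mul_x]; simp only [eq_comm]), add_mul, smul_mul_assoc, mul_assoc,
    mul_prod_ofFn_pow d_commute, monomial, monomial]

theorem monomial_mul_x (k : Fin n) (α β : Fin n → ℕ) :
    monomial K α β * x K k =
      x K k * monomial K α β + (β k : K) • monomial K α (β - Pi.single k 1) := by
  rw [monomial, mul_assoc, prod_ofFn_pow_mul (K := K) d_commute (fun j => d_mul_x j k),
    mul_add, mul_smul_comm, ← mul_assoc, ← (commute_prod_ofFn_pow x_commute k α).eq, mul_assoc,
    monomial]

@[simp] theorem monomial_zero : monomial K (0 : Fin n → ℕ) 0 = 1 := by simp [monomial]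

/-! ### The Bernstein filtration -/

theorem monomial_mem_W {α β : Fin n → ℕ} {r : ℤ} (h : (((∑ i, α i) + ∑ i, β i : ℕ) : ℤ) ≤ r) :
    monomial K α β ∈ W K n r :=
  Submodule.subset_span ⟨α, β, h, rfl⟩

theorem W_mono {r s : ℤ} (h : r ≤ s) : W K n r ≤ W K n s :=
  Submodule.span_mono fun _ ⟨α, β, hr, hD⟩ => ⟨α, β, hr.trans h, hD⟩

theorem W_eq_bot {r : ℤ} (h : r < 0) : W K n r = ⊥ := by
  rw [W, Submodule.span_eq_bot]
  rintro _ ⟨α, β, hr, -⟩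
  exact absurd (Int.natCast_nonneg _) (hr.trans_lt h).not_ge

theorem sum_add_single (α : Fin n → ℕ) (k : Fin n) :
    ∑ i, (α + Pi.single k 1 : Fin n → ℕ) i = ∑ i, α i + 1 := by
  simp [Finset.sum_add_distrib]

theorem sum_sub_single {α : Fin n → ℕ} {k : Fin n} (h : α k ≠ 0) :
    ∑ i, (α - Pi.single k 1 : Fin n → ℕ) i + 1 = ∑ i, α i := by
  rw [← sum_add_single, Pi.sub_single_add_single h]

theorem x_mul_mem_W (k : Fin n) {D : WeylAlgebra K n} {r : ℤ} (hD : D ∈ W K n r) :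
    x K k * D ∈ W K n (r + 1) := by
  induction hD using Submodule.span_induction with
  | mem D hD =>
    obtain ⟨α, β, h, rfl⟩ := hD
    rw [x_mul_monomial]
    refine monomial_mem_W ?_
    rw [sum_add_single]
    push_cast at h ⊢
    linarith
  | zero => simp
  | add D E _ _ h1 h2 => rw [mul_add]; exact add_mem h1 h2
  | smul c D _ h => rw [mul_smul_comm]; exact Submodule.smul_mem _ _ h

theorem d_mul_mem_W (k : Fin n) {D : WeylAlgebra K n} {r : ℤ} (hD : D ∈ W K n r) :
    d K k * D ∈ W K n (r + 1) := by
  induction hD using Submodule.span_induction with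
  | mem D hD =>
    obtain ⟨α, β, h, rfl⟩ := hD
    rw [d_mul_monomial]
    refine add_mem (monomial_mem_W ?_) (Submodule.smul_mem _ _ (monomial_mem_W ?_))
    · rw [sum_add_single]
      push_cast at h ⊢
      linarith
    · have : ∑ i, (α - Pi.single k 1 : Fin n → ℕ) i ≤ ∑ i, α i :=
        Finset.sum_le_sum fun i _ => Nat.sub_le _ _
      push_cast at h ⊢
      zify at this
      linarith
  | zero => simp
  | add D E _ _ h1 h2 => rw [mul_add]; exact add_mem h1 h2
  | smul c D _ h => rw [mul_smul_comm]; exact Submodule.smul_mem _ _ h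

theorem mul_mem_W {D E : WeylAlgebra K n} {r s : ℤ} (hD : D ∈ W K n r) (hE : E ∈ W K n s) :
    D * E ∈ W K n (r + s) := by
  have hx : ∀ (α : Fin n → ℕ) {E : WeylAlgebra K n} {s : ℤ}, E ∈ W K n s →
      (List.ofFn fun i => x K i ^ α i).prod * E ∈ W K n ((∑ i, α i : ℕ) + s) := by
    intro α E s hE
    induction α using pi_nat_induction with
    | zero => simpa using hE
    | step α k ih =>
      rw [← mul_prod_ofFn_pow x_commute, mul_assoc, sum_add_single]
      refine W_mono (le_of_eq ?_) (x_mul_mem_W k ih)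
      push_cast
      ring
  have hd : ∀ (α : Fin n → ℕ) {E : WeylAlgebra K n} {s : ℤ}, E ∈ W K n s →
      (List.ofFn fun i => d K i ^ α i).prod * E ∈ W K n ((∑ i, α i : ℕ) + s) := by
    intro α E s hE
    induction α using pi_nat_induction with
    | zero => simpa using hE
    | step α k ih =>
      rw [← mul_prod_ofFn_pow d_commute, mul_assoc, sum_add_single]
      refine W_mono (le_of_eq ?_) (d_mul_mem_W k ih)
      push_cast
      ring
  induction hD using Submodule.span_induction with
  | mem D hD =>
    obtain ⟨α, β, h, rfl⟩ := hD
    rw [monomial, mul_assoc]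
    refine W_mono ?_ (hx α (hd β hE))
    push_cast at h ⊢
    linarith
  | zero => simp
  | add D E _ _ h1 h2 => rw [add_mul]; exact add_mem h1 h2
  | smul c D _ h => rw [smul_mul_assoc]; exact Submodule.smul_mem _ _ h

theorem one_mem_W {r : ℤ} (hr : 0 ≤ r) : (1 : WeylAlgebra K n) ∈ W K n r := by
  rw [← monomial_zero]
  exact monomial_mem_W (by simpa using hr)

theorem x_mem_W (k : Fin n) : x K k ∈ W K n 1 := by
  have := x_mul_mem_W k (one_mem_W (K := K) (n := n) le_rfl)
  rwa [mul_one] at this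

theorem d_mem_W (k : Fin n) : d K k ∈ W K n 1 := by
  have := d_mul_mem_W k (one_mem_W (K := K) (n := n) le_rfl)
  rwa [mul_one] at this

/-- The Bernstein filtration is exhaustive. -/
theorem exists_mem_W (D : WeylAlgebra K n) : ∃ r : ℕ, D ∈ W K n r := by
  have hle : ∀ r s : ℕ, W K n r ≤ W K n (r + s : ℕ) := fun r s =>
    W_mono (Int.ofNat_le.2 (Nat.le_add_right r s))
  have hle' : ∀ r s : ℕ, W K n s ≤ W K n (r + s : ℕ) := fun r s =>
    W_mono (Int.ofNat_le.2 (Nat.le_add_left s r))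
  have key : ∀ (D : Module.End K (MvPolynomial (Fin n) K)) (_ : D ∈ WeylAlgebra K n),
      ∃ r : ℕ, ∃ E ∈ W K n r, E.1 = D := by
    intro D hD
    refine Algebra.adjoin_induction (p := fun D _ => ∃ r : ℕ, ∃ E ∈ W K n r, E.1 = D)
      ?_ ?_ ?_ ?_ hD
    · rintro _ (⟨k, rfl⟩ | ⟨k, rfl⟩)
      · exact ⟨1, x K k, x_mem_W k, rfl⟩
      · exact ⟨1, d K k, d_mem_W k, rfl⟩
    · intro c
      refine ⟨0, c • 1, Submodule.smul_mem _ c (one_mem_W le_rfl), ?_⟩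
      exact (Algebra.algebraMap_eq_smul_one c).symm
    · rintro _ _ - - ⟨r, D, hD, rfl⟩ ⟨s, E, hE, rfl⟩
      exact ⟨r + s, D + E, add_mem (hle r s hD) (hle' r s hE), rfl⟩
    · rintro _ _ - - ⟨r, D, hD, rfl⟩ ⟨s, E, hE, rfl⟩
      refine ⟨r + s, D * E, ?_, rfl⟩
      rw [Nat.cast_add]
      exact mul_mem_W hD hE
  obtain ⟨r, E, hE, h⟩ := key D.1 D.2
  exact ⟨r, Subtype.ext h ▸ hE⟩

/-- Commutators with the variables lower the order. -/
theorem exists_mul_x_eq (k : Fin n) {D : WeylAlgebra K n} {r : ℤ} (hD : D ∈ W K n r) :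
    ∃ E ∈ W K n (r - 1), D * x K k = x K k * D + E := by
  induction hD using Submodule.span_induction with
  | mem D hD =>
    obtain ⟨α, β, h, rfl⟩ := hD
    refine ⟨_, ?_, monomial_mul_x k α β⟩
    rcases eq_or_ne (β k) 0 with h0 | h0
    · rw [h0, Nat.cast_zero, zero_smul]
      exact zero_mem _
    · refine Submodule.smul_mem _ _ (monomial_mem_W ?_)
      have := sum_sub_single h0
      zify at this
      push_cast at h ⊢
      linarith
  | zero => exact ⟨0, zero_mem _, by rw [zero_mul, mul_zero, add_zero]⟩
  | add D D' _ _ h1 h2 =>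
    obtain ⟨E, hE, h1⟩ := h1
    obtain ⟨E', hE', h2⟩ := h2
    exact ⟨E + E', add_mem hE hE', by rw [add_mul, mul_add, h1, h2, add_add_add_comm]⟩
  | smul c D _ h =>
    obtain ⟨E, hE, h⟩ := h
    exact ⟨c • E, Submodule.smul_mem _ _ hE, by
      rw [mul_smul_comm, smul_mul_assoc, h, smul_add]⟩

/-- Commutators with the derivations lower the order. -/
theorem exists_d_mul_eq (k : Fin n) {D : WeylAlgebra K n} {r : ℤ} (hD : D ∈ W K n r) :
    ∃ E ∈ W K n (r - 1), d K k * D = D * d K k + E := by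
  induction hD using Submodule.span_induction with
  | mem D hD =>
    obtain ⟨α, β, h, rfl⟩ := hD
    refine ⟨_, ?_, by rw [d_mul_monomial, monomial_mul_d]⟩
    rcases eq_or_ne (α k) 0 with h0 | h0
    · rw [h0, Nat.cast_zero, zero_smul]
      exact zero_mem _
    · refine Submodule.smul_mem _ _ (monomial_mem_W ?_)
      have := sum_sub_single h0
      zify at this
      push_cast at h ⊢
      linarith
  | zero => exact ⟨0, zero_mem _, by rw [zero_mul, mul_zero, add_zero]⟩
  | add D D' _ _ h1 h2 =>
    obtain ⟨E, hE, h1⟩ := h1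
    obtain ⟨E', hE', h2⟩ := h2
    exact ⟨E + E', add_mem hE hE', by rw [add_mul, mul_add, h1, h2, add_add_add_comm]⟩
  | smul c D _ h =>
    obtain ⟨E, hE, h⟩ := h
    exact ⟨c • E, Submodule.smul_mem _ _ hE, by
      rw [mul_smul_comm, smul_mul_assoc, h, smul_add]⟩

end WeylAlgebra

namespace WeylAlgebra

variable {K : Type*} [Field K] {n : ℕ}

/-! ### The action on polynomials -/

/-- Evaluation of an operator at a polynomial, as a linear map in the operator. -/
noncomputable def evalAt (f : MvPolynomial (Fin n) K) :
    WeylAlgebra K n →ₗ[K] MvPolynomial (Fin n) K :=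
  LinearMap.applyₗ f ∘ₗ (WeylAlgebra K n).val.toLinearMap

theorem evalAt_mul (D E : WeylAlgebra K n) (f : MvPolynomial (Fin n) K) :
    evalAt f (D * E) = evalAt (evalAt f E) D := rfl

theorem evalAt_x (k : Fin n) (f : MvPolynomial (Fin n) K) :
    evalAt f (x K k) = MvPolynomial.X k * f := rfl

theorem evalAt_d (k : Fin n) (f : MvPolynomial (Fin n) K) :
    evalAt f (d K k) = MvPolynomial.pderiv k f := rfl

theorem evalAt_one (f : MvPolynomial (Fin n) K) : evalAt f (1 : WeylAlgebra K n) = f := rfl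

open Finsupp in
theorem equivFunOnFinite_symm_add_single (α : Fin n → ℕ) (k : Fin n) :
    equivFunOnFinite.symm (α + Pi.single k 1) = equivFunOnFinite.symm α + single k 1 := by
  ext i
  simp [Finsupp.single_apply, Pi.single_apply, eq_comm]

open Finsupp in
theorem equivFunOnFinite_symm_sub_single (α : Fin n → ℕ) (k : Fin n) :
    equivFunOnFinite.symm (α - Pi.single k 1) = equivFunOnFinite.symm α - single k 1 := by
  ext i
  simp [Finsupp.single_apply, Pi.single_apply, eq_comm]

open Finsupp in
theorem evalAt_prod_x (α : Fin n → ℕ) (f : MvPolynomial (Fin n) K) :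
    evalAt f (List.ofFn fun i => x K i ^ α i).prod =
      MvPolynomial.monomial (equivFunOnFinite.symm α) 1 * f := by
  induction α using pi_nat_induction with
  | zero =>
    have : equivFunOnFinite.symm (0 : Fin n → ℕ) = 0 := by ext; simp
    simp [evalAt_one, this]
  | step α k ih =>
    rw [← mul_prod_ofFn_pow x_commute, evalAt_mul, ih, evalAt_x, equivFunOnFinite_symm_add_single,
      add_comm, MvPolynomial.monomial_single_add, pow_one, mul_assoc]

open Finsupp in
/-- The operator `∂^β` sends `x^γ` to a multiple of `x^(γ - β)`, which vanishes unless `β ≤ γ`. -/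
theorem evalAt_prod_d (β γ : Fin n → ℕ) : ∃ c : ℕ, (c ≠ 0 ↔ β ≤ γ) ∧
    evalAt (MvPolynomial.monomial (equivFunOnFinite.symm γ) 1)
        (List.ofFn fun i => d K i ^ β i).prod =
      MvPolynomial.monomial (equivFunOnFinite.symm (γ - β)) (c : K) := by
  induction β using pi_nat_induction generalizing γ with
  | zero => exact ⟨1, by simp, by simp [evalAt_one]⟩
  | step β k ih =>
    obtain ⟨c, hc, h⟩ := ih (γ - Pi.single k 1)
    refine ⟨γ k * c, ?_, ?_⟩
    · rw [mul_ne_zero_iff, hc]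
      constructor
      · rintro ⟨h0, h1⟩
        rw [← Pi.sub_single_add_single h0]
        exact add_le_add_left h1 _
      · intro h1
        have h2 := h1 k
        simp only [Pi.add_apply, Pi.single_eq_same] at h2
        exact ⟨by omega, le_tsub_of_add_le_right h1⟩
    · rw [← mul_prod_ofFn_pow d_commute, (commute_prod_ofFn_pow d_commute k β).eq, evalAt_mul,
        evalAt_d, MvPolynomial.pderiv_monomial, one_mul, ← equivFunOnFinite_symm_sub_single]
      have : MvPolynomial.monomial (equivFunOnFinite.symm (γ - Pi.single k 1)) (γ k : K) =
          (γ k : K) • MvPolynomial.monomial (equivFunOnFinite.symm (γ - Pi.single k 1)) 1 := by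
        rw [MvPolynomial.smul_monomial, smul_eq_mul, mul_one]
      have hsmul : ∀ (a : K) (f : MvPolynomial (Fin n) K) (D : WeylAlgebra K n),
          evalAt (a • f) D = a • evalAt f D := fun a f D => D.1.map_smul a f
      rw [equivFunOnFinite_symm_apply_apply, this, hsmul, h, MvPolynomial.smul_monomial,
        smul_eq_mul, tsub_tsub, add_comm (Pi.single k 1) β, Nat.cast_mul]

open Finsupp in
/-- In characteristic zero the monomials `x^α ∂^β` are linearly independent: if the coefficients
of all `x^α ∂^β'` with `β' < β` vanish, then applying the combination to `x^β` isolates those with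
`β' = β`. -/
theorem eq_zero_of_sum_smul_monomial_eq_zero [CharZero K] (s : Finset ((Fin n → ℕ) × (Fin n → ℕ)))
    (c : (Fin n → ℕ) × (Fin n → ℕ) → K) (h : ∑ q ∈ s, c q • monomial K q.1 q.2 = 0) :
    ∀ q ∈ s, c q = 0 := by
  classical
  suffices H : ∀ β α : Fin n → ℕ, (α, β) ∈ s → c (α, β) = 0 from fun q hq => H q.2 q.1 hq
  intro β
  induction β using WellFoundedLT.induction with
  | ind β ih =>
    intro α hα
    have h1 := congrArg (evalAt (MvPolynomial.monomial (equivFunOnFinite.symm β) 1)) h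
    obtain ⟨b, hb, hb'⟩ := evalAt_prod_d (K := K) β β
    rw [map_sum, map_zero] at h1
    have h2 : ∀ q ∈ s, evalAt (MvPolynomial.monomial (equivFunOnFinite.symm β) 1)
        (c q • monomial K q.1 q.2) =
        if q.2 = β then MvPolynomial.monomial (equivFunOnFinite.symm q.1) (c q * b) else 0 := by
      rintro ⟨α', β'⟩ hq
      rw [map_smul, monomial, evalAt_mul, evalAt_prod_x]
      split_ifs with h3
      · dsimp only at h3 ⊢
        subst h3
        have h0 : equivFunOnFinite.symm (0 : Fin n → ℕ) = 0 := by ext; simp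
        rw [hb', tsub_self, h0, MvPolynomial.monomial_mul, add_zero, one_mul,
          MvPolynomial.smul_monomial, smul_eq_mul]
      · by_cases h4 : β' ≤ β
        · rw [ih β' (lt_of_le_of_ne h4 h3) α' hq, zero_smul]
        · obtain ⟨e, he, he'⟩ := evalAt_prod_d (K := K) β' β
          have : e = 0 := not_not.1 (he.not.2 h4)
          rw [he', this, Nat.cast_zero, map_zero, mul_zero, smul_zero]
    rw [Finset.sum_congr rfl h2] at h1
    have h3 := congrArg (MvPolynomial.coeff (equivFunOnFinite.symm α)) h1
    rw [MvPolynomial.coeff_sum, Finset.sum_eq_single (α, β) ?_ (fun h => absurd hα h)] at h3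
    · have hb0 : (b : K) ≠ 0 := Nat.cast_ne_zero.2 (hb.2 le_rfl)
      simpa [hb0] using h3
    · rintro ⟨α', β'⟩ - hne
      dsimp only
      split_ifs with h4
      · rw [MvPolynomial.coeff_monomial, if_neg]
        intro h5
        exact hne (by rw [h4, equivFunOnFinite.symm.injective h5])
      · exact MvPolynomial.coeff_zero _

/-- In characteristic zero an operator commuting with all variables and all derivations is a
scalar. -/
theorem exists_eq_smul_one_of_commute [CharZero K] {D : WeylAlgebra K n}
    (hx : ∀ k, D * x K k = x K k * D) (hd : ∀ k, d K k * D = D * d K k) :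
    ∃ c : K, D = c • 1 := by
  have h1 : ∀ f, evalAt f D = f * evalAt 1 D := by
    intro f
    induction f using MvPolynomial.induction_on with
    | C a =>
      rw [← mul_one (MvPolynomial.C a), ← MvPolynomial.smul_eq_C_mul, smul_mul_assoc, one_mul]
      exact D.1.map_smul a 1
    | add f g hf hg => rw [add_mul, ← hf, ← hg]; exact D.1.map_add f g
    | mul_X f k hf =>
      have := congrArg (evalAt f) (hx k)
      rw [evalAt_mul, evalAt_mul, evalAt_x, evalAt_x, hf] at this
      rw [mul_comm f, this, mul_assoc]
  have h2 : ∀ k, MvPolynomial.pderiv k (evalAt 1 D) = 0 := by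
    intro k
    have := congrArg (evalAt 1) (hd k)
    rw [evalAt_mul, evalAt_mul, evalAt_d, evalAt_d, MvPolynomial.pderiv_one] at this
    rw [this]
    exact D.1.map_zero
  have h3 : evalAt 1 D = MvPolynomial.C (MvPolynomial.coeff 0 (evalAt 1 D)) := by
    ext m
    rw [MvPolynomial.coeff_C]
    split_ifs with hm
    · rw [hm]
    · obtain ⟨k, hk⟩ : ∃ k, m k ≠ 0 := by
        by_contra! hc
        exact hm (Finsupp.ext fun k => (hc k).symm)
      have h4 := congrArg (MvPolynomial.coeff (m - Finsupp.single k 1)) (h2 k)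
      have h5 : m - Finsupp.single k 1 + Finsupp.single k 1 = m := by
        refine tsub_add_cancel_of_le ?_
        rw [Finsupp.single_le_iff]
        exact Nat.one_le_iff_ne_zero.2 hk
      rw [MvPolynomial.coeff_pderiv, h5, MvPolynomial.coeff_zero] at h4
      refine (mul_eq_zero.1 h4).resolve_right ?_
      exact Nat.cast_add_one_ne_zero _
  refine ⟨MvPolynomial.coeff 0 (evalAt 1 D), Subtype.ext <| LinearMap.ext fun f => ?_⟩
  refine (h1 f).trans ?_
  rw [h3, mul_comm, ← MvPolynomial.smul_eq_C_mul, ← h3]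
  rfl

end WeylAlgebra

/-! ### Degrees of polynomials and growth -/

open Filter in
theorem Polynomial.degree_le_of_eventually_eval_le {p q : Polynomial ℚ}
    (h : ∀ᶠ t : ℕ in atTop, 0 ≤ p.eval (t : ℚ) ∧ p.eval (t : ℚ) ≤ q.eval (t : ℚ)) :
    p.degree ≤ q.degree := by
  by_contra! hlt
  have hp : p ≠ 0 := by
    rintro rfl
    simp at hlt
  have hcast : Tendsto (fun t : ℕ => (t : ℚ)) atTop atTop := tendsto_natCast_atTop_atTop
  have h1 := hcast.eventually ((Polynomial.isLittleO_atTop_of_degree_lt q p hlt).def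
    (show (0 : ℝ) < 1 / 2 by norm_num))
  have h2 := hcast.eventually (Polynomial.eventually_atTop_not_isRoot p hp)
  obtain ⟨t, ⟨h3, h4⟩, h5, h6⟩ := (h.and (h1.and h2)).exists
  rw [Polynomial.IsRoot.def] at h6
  have h7 : ‖q.eval (t : ℚ)‖ ≤ 1 / 2 * ‖p.eval (t : ℚ)‖ := h5
  rw [← Rat.norm_cast_real, ← Rat.norm_cast_real (p.eval _), Real.norm_eq_abs,
    Real.norm_eq_abs] at h7
  have h8 : |q.eval (t : ℚ)| ≤ 1 / 2 * |p.eval (t : ℚ)| := by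
    have : ((|q.eval (t : ℚ)| : ℚ) : ℝ) ≤ ((1 / 2 * |p.eval (t : ℚ)| : ℚ) : ℝ) := by
      push_cast
      exact h7
    exact_mod_cast this
  have h9 := le_abs_self (q.eval (t : ℚ))
  rw [abs_of_nonneg h3] at h8
  exact h6 (by linarith)

open Filter in
theorem Polynomial.eq_of_eventually_eval_eq {p q : Polynomial ℚ}
    (h : ∀ᶠ t : ℕ in atTop, p.eval (t : ℚ) = q.eval (t : ℚ)) : p = q := by
  refine Polynomial.eq_of_infinite_eval_eq p q ?_
  obtain ⟨N, hN⟩ := eventually_atTop.1 h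
  refine ((Set.Ici_infinite N).image (f := fun t : ℕ => (t : ℚ)) Nat.cast_injective.injOn).mono ?_
  rintro _ ⟨t, ht, rfl⟩
  exact hN t ht

namespace MvPolynomial

variable {ι : Type*}

theorem infinite_natCast_Ici (N : ℕ) : {x : ℚ | ∃ t : ℕ, N ≤ t ∧ x = t}.Infinite := by
  refine ((Set.Ici_infinite N).image (f := fun t : ℕ => (t : ℚ)) Nat.cast_injective.injOn).mono ?_
  rintro _ ⟨t, ht, rfl⟩
  exact ⟨t, ht, rfl⟩

theorem eq_of_eval_natCast_eq {P Q : MvPolynomial ι ℚ} (d₀ : ι → ℕ)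
    (h : ∀ d : ι → ℕ, d₀ ≤ d → eval (fun j => (d j : ℚ)) P = eval (fun j => (d j : ℚ)) Q) :
    P = Q := by
  refine MvPolynomial.funext_set (fun j => {x : ℚ | ∃ t : ℕ, d₀ j ≤ t ∧ x = t})
    (fun j => infinite_natCast_Ici (d₀ j)) fun y hy => ?_
  choose d hd hyd using fun j => hy j (Set.mem_univ j)
  obtain rfl : y = fun j => (d j : ℚ) := _root_.funext hyd
  exact h d hd

/-- The restriction of a polynomial to the line through the origin with direction `a`. -/
noncomputable def alongLine (a : ι → ℚ) : MvPolynomial ι ℚ →ₐ[ℚ] Polynomial ℚ :=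
  aeval fun j => Polynomial.C (a j) * Polynomial.X

theorem eval_alongLine (a : ι → ℚ) (P : MvPolynomial ι ℚ) (t : ℚ) :
    (alongLine a P).eval t = eval (fun j => a j * t) P := by
  induction P using MvPolynomial.induction_on with
  | C c => simp [alongLine]
  | add P Q hP hQ => simp [hP, hQ]
  | mul_X P j hP =>
    rw [map_mul, Polynomial.eval_mul, hP, map_mul, eval_X]
    simp [alongLine]

theorem alongLine_monomial (a : ι → ℚ) (m : ι →₀ ℕ) (c : ℚ) :
    alongLine a (monomial m c) =
      Polynomial.C (eval a (monomial m c)) * Polynomial.X ^ m.degree := by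
  rw [alongLine, aeval_monomial, eval_monomial, Finsupp.prod, Finsupp.prod, map_mul, map_prod,
    Finsupp.degree_apply, ← Finset.prod_pow_eq_pow_sum, mul_assoc, ← Finset.prod_mul_distrib]
  congr 1
  refine Finset.prod_congr rfl fun j _ => ?_
  rw [mul_pow, Polynomial.C_pow]

/-- The coefficients of the restriction to a line are the values of the homogeneous components at
the direction of the line. -/
theorem coeff_alongLine (a : ι → ℚ) (P : MvPolynomial ι ℚ) (k : ℕ) :
    (alongLine a P).coeff k = eval a (homogeneousComponent k P) := by
  induction P using MvPolynomial.induction_on' with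
  | monomial m c =>
    rw [alongLine_monomial, Polynomial.coeff_C_mul_X_pow]
    split_ifs with h
    · rw [homogeneousComponent_of_mem (isHomogeneous_monomial c rfl), if_pos h]
    · rw [homogeneousComponent_of_mem (isHomogeneous_monomial c rfl), if_neg h, map_zero]
  | add P Q hP hQ => rw [map_add, Polynomial.coeff_add, hP, hQ, map_add, map_add]

theorem natDegree_alongLine_le (a : ι → ℚ) (P : MvPolynomial ι ℚ) :
    (alongLine a P).natDegree ≤ P.totalDegree := by
  refine Polynomial.natDegree_le_iff_coeff_eq_zero.2 fun k hk => ?_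
  rw [coeff_alongLine, homogeneousComponent_eq_zero _ _ hk, map_zero]

/-- The total degree is attained on some line with positive integral direction. -/
theorem totalDegree_le_of_natDegree_alongLine_le {P : MvPolynomial ι ℚ} {N : ℕ}
    (h : ∀ a : ι → ℕ, (∀ j, 1 ≤ a j) → (alongLine (fun j => (a j : ℚ)) P).natDegree ≤ N) :
    P.totalDegree ≤ N := by
  refine Finset.sup_le fun m hm => ?_
  by_contra! hlt
  change N < m.degree at hlt
  have h0 : homogeneousComponent m.degree P = 0 := by
    refine eq_of_eval_natCast_eq (fun _ => 1) fun a ha => ?_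
    rw [← coeff_alongLine, map_zero]
    exact Polynomial.coeff_eq_zero_of_natDegree_lt ((h a ha).trans_lt hlt)
  have h1 := congrArg (coeff m) h0
  rw [coeff_homogeneousComponent, if_pos rfl, coeff_zero] at h1
  exact mem_support_iff.1 hm h1

/-- If the values of `P` at large integral points are nonnegative and monotone, then `P` has
the degree of its restriction to the diagonal: at the point `t a` of the line with direction `a`,
the polynomial is bounded by its value at a diagonal point `(A t, …, A t)` with `a ≤ A`. -/
theorem natDegree_alongLine_one_eq_totalDegree [Fintype ι] {P : MvPolynomial ι ℚ} (d₀ : ι → ℕ)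
    (h0 : ∀ d : ι → ℕ, d₀ ≤ d → 0 ≤ eval (fun j => (d j : ℚ)) P)
    (h1 : ∀ d d' : ι → ℕ, d₀ ≤ d → d ≤ d' →
      eval (fun j => (d j : ℚ)) P ≤ eval (fun j => (d' j : ℚ)) P) :
    (alongLine (fun _ => 1) P).natDegree = P.totalDegree := by
  refine (natDegree_alongLine_le _ P).antisymm (totalDegree_le_of_natDegree_alongLine_le ?_)
  intro a ha
  -- Any bound for all the `a j` would do.
  let A := ∑ j, a j
  have hle : (alongLine (fun j => (a j : ℚ)) P).degree ≤
      ((alongLine (fun _ => 1) P).comp (Polynomial.C (A : ℚ) * Polynomial.X)).degree := by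
    refine Polynomial.degree_le_of_eventually_eval_le ?_
    filter_upwards [Filter.eventually_ge_atTop (∑ j, d₀ j)] with t ht
    have hd : d₀ ≤ fun j => a j * t := fun j =>
      ((Finset.single_le_sum (f := d₀) (fun _ _ => Nat.zero_le _) (Finset.mem_univ j)).trans
        ht).trans (Nat.le_mul_of_pos_left t (ha j))
    have hd' : (fun j => a j * t) ≤ fun _ => A * t := fun j =>
      Nat.mul_le_mul_right t
        (Finset.single_le_sum (f := a) (fun _ _ => Nat.zero_le _) (Finset.mem_univ j))
    have e0 := h0 _ hd
    have e1 := h1 _ _ hd hd'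
    rw [eval_alongLine, Polynomial.eval_comp, eval_alongLine]
    simp only [Nat.cast_mul] at e0 e1
    simp only [Polynomial.eval_mul, Polynomial.eval_C, Polynomial.eval_X, one_mul]
    exact ⟨e0, e1⟩
  refine (Polynomial.natDegree_le_natDegree hle).trans (Polynomial.natDegree_comp_le.trans ?_)
  calc _ ≤ (alongLine (fun _ => 1) P).natDegree * 1 :=
        Nat.mul_le_mul_left _ ((Polynomial.natDegree_C_mul_le _ _).trans Polynomial.natDegree_X_le)
    _ = _ := mul_one _

end MvPolynomial

namespace WeylAlgebra

/-! ### Filtrations of modules -/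

section Filtration

variable {K : Type*} [Field K] {n : ℕ} {M : Type*} [AddCommGroup M] [Module K M]
  [Module (WeylAlgebra K n) M] [IsScalarTower K (WeylAlgebra K n) M] {p : ℕ}

theorem W_le_W₂ (r : ℤ) : W K n r ≤ W₂ K n r r := by
  refine Submodule.span_mono ?_
  rintro _ ⟨α, β, h, rfl⟩
  push_cast at h
  have h1 : (0 : ℤ) ≤ ((∑ i, α i : ℕ) : ℤ) := Int.natCast_nonneg _
  have h2 : (0 : ℤ) ≤ ((∑ i, β i : ℕ) : ℤ) := Int.natCast_nonneg _
  push_cast at h1 h2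
  refine ⟨α, β, ?_, ?_, rfl⟩ <;> push_cast <;> linarith

theorem W₂_le_W (r s : ℤ) : W₂ K n r s ≤ W K n (r + s) := by
  refine Submodule.span_mono ?_
  rintro _ ⟨α, β, h1, h2, rfl⟩
  refine ⟨α, β, ?_, rfl⟩
  push_cast at h1 h2 ⊢
  linarith

theorem W₂_mono {r s r' s' : ℤ} (hr : r ≤ r') (hs : s ≤ s') : W₂ K n r s ≤ W₂ K n r' s' :=
  Submodule.span_mono fun _ ⟨α, β, h1, h2, hD⟩ => ⟨α, β, h1.trans hr, h2.trans hs, hD⟩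

theorem sumSMul_mono {V V' : Submodule K (WeylAlgebra K n)} (h : V ≤ V') (g : Fin p → M) :
    sumSMul V g ≤ sumSMul V' g :=
  iSup_mono fun _ => Submodule.map_mono h

theorem smul_mem_sumSMul {V : Submodule K (WeylAlgebra K n)} {D : WeylAlgebra K n} (hD : D ∈ V)
    (g : Fin p → M) (i : Fin p) : D • g i ∈ sumSMul V g :=
  Submodule.mem_iSup_of_mem i ⟨D, hD, rfl⟩

/-- The vectors `x^α ∂^β g_i`, the pair `(α, β)` being encoded as one exponent in `2n` variables. -/
noncomputable def vec (g : Fin p → M) (q : Fin p × (Fin n ⊕ Fin n → ℕ)) : M :=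
  monomial K (q.2 ∘ Sum.inl) (q.2 ∘ Sum.inr) • g q.1

theorem sumSMul_span (S : Set ((Fin n → ℕ) × (Fin n → ℕ))) (g : Fin p → M) :
    sumSMul (Submodule.span K {D | ∃ α β : Fin n → ℕ, (α, β) ∈ S ∧ D = monomial K α β}) g =
      Submodule.span K (vec (K := K) (n := n) g '' {q | (q.2 ∘ Sum.inl, q.2 ∘ Sum.inr) ∈ S}) := by
  refine le_antisymm (iSup_le fun i => ?_) (Submodule.span_le.2 ?_)
  · rw [Submodule.map_span, Submodule.span_le]
    rintro _ ⟨_, ⟨α, β, h, rfl⟩, rfl⟩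
    exact Submodule.subset_span (Set.mem_image_of_mem (vec (K := K) (n := n) g)
      (show (i, Sum.elim α β) ∈ _ from h))
  · rintro _ ⟨q, hq, rfl⟩
    refine smul_mem_sumSMul (Submodule.subset_span ?_) g q.1
    exact ⟨_, _, hq, rfl⟩

theorem sumSMul_W (r : ℕ) (g : Fin p → M) : sumSMul (W K n r) g =
    Submodule.span K
      (vec (K := K) (n := n) g '' {q | fiberSum (fun _ => ()) q.2 ≤ fun _ => r}) := by
  have h1 : W K n r = Submodule.span K {D | ∃ α β : Fin n → ℕ,
      (α, β) ∈ {q : (Fin n → ℕ) × (Fin n → ℕ) | ∑ i, q.1 i + ∑ i, q.2 i ≤ r} ∧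
        D = monomial K α β} := by
    simp only [W, Nat.cast_le, Set.mem_ofPred_eq]
  rw [h1, sumSMul_span]
  congr 2
  ext q
  simp [fiberSum, Pi.le_def]

theorem sumSMul_W₂ (r s : ℕ) (g : Fin p → M) : sumSMul (W₂ K n r s) g =
    Submodule.span K (vec (K := K) (n := n) g ''
      {q | fiberSum (Sum.elim (fun _ => 0) (fun _ => 1)) q.2 ≤ (![r, s] : Fin 2 → ℕ)}) := by
  have h1 : W₂ K n r s = Submodule.span K {D | ∃ α β : Fin n → ℕ,
      (α, β) ∈ {q : (Fin n → ℕ) × (Fin n → ℕ) | ∑ i, q.1 i ≤ r ∧ ∑ i, q.2 i ≤ s} ∧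
        D = monomial K α β} := by
    simp only [W₂, Nat.cast_le, Set.mem_ofPred_eq, and_assoc]
  rw [h1, sumSMul_span]
  congr 2
  ext q
  simp [fiberSum, Pi.le_def, Finset.sum_filter]

instance (r : ℕ) (g : Fin p → M) : FiniteDimensional K (sumSMul (W K n r) g) := by
  rw [sumSMul_W]
  refine FiniteDimensional.span_of_finite K (Set.Finite.image _ ?_)
  exact (Set.finite_univ.prod (finite_fiberSum_le _ _)).subset fun q hq => ⟨Set.mem_univ _, hq⟩

instance (r s : ℕ) (g : Fin p → M) : FiniteDimensional K (sumSMul (W₂ K n r s) g) := by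
  rw [sumSMul_W₂]
  refine FiniteDimensional.span_of_finite K (Set.Finite.image _ ?_)
  exact (Set.finite_univ.prod (finite_fiberSum_le _ _)).subset fun q hq => ⟨Set.mem_univ _, hq⟩

/-- Multiplication by `x_k` raises an exponent exactly; multiplication by `∂_k` does so up to the
term `α_k x^(α - e_k) ∂^β`. -/
theorem eventuallyPolynomial_finrank_span_vec {ι : Type*} [Fintype ι] [DecidableEq ι]
    (w : Fin n ⊕ Fin n → ι) (g : Fin p → M) : EventuallyPolynomial fun d =>
      Module.finrank K
        (Submodule.span K (vec (K := K) (n := n) g '' {q | fiberSum w q.2 ≤ d})) := by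
  refine eventuallyPolynomial_finrank_span w (vec g)
    (Sum.elim (fun k => Algebra.lsmul K K M (x K k)) (fun k => Algebra.lsmul K K M (d K k))) ?_
  have hl : ∀ (a : Fin n ⊕ Fin n → ℕ) (k : Fin n),
      (a + Pi.single (Sum.inl k) 1 : Fin n ⊕ Fin n → ℕ) ∘ Sum.inl = a ∘ Sum.inl + Pi.single k 1 ∧
      (a + Pi.single (Sum.inl k) 1 : Fin n ⊕ Fin n → ℕ) ∘ Sum.inr = a ∘ Sum.inr := by
    intro a k
    constructor <;> funext l <;> simp [Pi.single_apply]
  have hr : ∀ (a : Fin n ⊕ Fin n → ℕ) (k : Fin n),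
      (a + Pi.single (Sum.inr k) 1 : Fin n ⊕ Fin n → ℕ) ∘ Sum.inl = a ∘ Sum.inl ∧
      (a + Pi.single (Sum.inr k) 1 : Fin n ⊕ Fin n → ℕ) ∘ Sum.inr =
        a ∘ Sum.inr + Pi.single k 1 := by
    intro a k
    constructor <;> funext l <;> simp [Pi.single_apply]
  rintro (k | k) i a
  · have : vec (K := K) g (i, a + Pi.single (Sum.inl k) 1) = x K k • vec (K := K) g (i, a) := by
      rw [vec, vec, smul_smul, x_mul_monomial, (hl a k).1, (hl a k).2]
    rw [this, Sum.elim_inl, Algebra.lsmul_coe, sub_self]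
    exact zero_mem _
  · have : d K k • vec (K := K) g (i, a) = vec (K := K) g (i, a + Pi.single (Sum.inr k) 1) +
        (a (Sum.inl k) : K) •
          vec (K := K) g (i, Sum.elim (a ∘ Sum.inl - Pi.single k 1) (a ∘ Sum.inr)) := by
      rw [vec, vec, vec, smul_smul, d_mul_monomial, (hr a k).1, (hr a k).2, add_smul, smul_assoc]
      rfl
    rw [Sum.elim_inr]
    change d K k • vec (K := K) g (i, a) - _ ∈ _
    rw [this, add_sub_cancel_left]
    refine Submodule.smul_mem _ _ (Submodule.subset_span ⟨_, ?_, rfl⟩)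
    rintro (l | l)
    · exact Nat.sub_le _ _
    · exact le_rfl

theorem smul_mem_sumSMul_W {D : WeylAlgebra K n} {r s : ℤ} (hD : D ∈ W K n r) {g : Fin p → M}
    {m : M} (hm : m ∈ sumSMul (W K n s) g) : D • m ∈ sumSMul (W K n (r + s)) g := by
  have : sumSMul (W K n s) g ≤ (sumSMul (W K n (r + s)) g).comap (Algebra.lsmul K K M D) := by
    refine iSup_le fun i => Submodule.map_le_iff_le_comap.2 fun E hE => ?_
    change D • E • g i ∈ sumSMul (W K n (r + s)) g
    rw [smul_smul]
    exact smul_mem_sumSMul (mul_mem_W hD hE) g i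
  exact this hm

/-- The filtration defined by a system of generators is exhaustive. -/
theorem exists_mem_sumSMul_W {g : Fin p → M}
    (hg : Submodule.span (WeylAlgebra K n) (Set.range g) = ⊤) (m : M) :
    ∃ r : ℕ, m ∈ sumSMul (W K n r) g := by
  obtain ⟨D, rfl⟩ := (Submodule.mem_span_range_iff_exists_fun (WeylAlgebra K n)).1
    (hg ▸ Submodule.mem_top : m ∈ Submodule.span (WeylAlgebra K n) (Set.range g))
  choose r hr using fun i => exists_mem_W (D i)
  refine ⟨∑ i, r i, sum_mem fun i _ => smul_mem_sumSMul (W_mono ?_ (hr i)) g i⟩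
  exact_mod_cast Finset.single_le_sum (f := r) (fun _ _ => Nat.zero_le _) (Finset.mem_univ i)

/-- Any two filtrations defined by finite systems are comparable up to a shift, provided that the
larger one comes from a system of generators. -/
theorem exists_sumSMul_W_le {p' : ℕ} {g : Fin p → M}
    (hg : Submodule.span (WeylAlgebra K n) (Set.range g) = ⊤) (g' : Fin p' → M) :
    ∃ k : ℕ, ∀ r : ℕ, sumSMul (W K n r) g' ≤ sumSMul (W K n (r + k : ℕ)) g := by
  choose k hk using fun j => exists_mem_sumSMul_W hg (g' j)
  refine ⟨∑ j, k j, fun r => iSup_le fun j => Submodule.map_le_iff_le_comap.2 fun D hD => ?_⟩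
  change D • g' j ∈ sumSMul (W K n (r + (∑ j, k j) : ℕ)) g
  refine sumSMul_mono (W_mono ?_) g (smul_mem_sumSMul_W hD (hk j))
  have : k j ≤ ∑ j, k j :=
    Finset.single_le_sum (f := k) (fun _ _ => Nat.zero_le _) (Finset.mem_univ j)
  exact_mod_cast Nat.add_le_add_left this r

/-! ### Bernstein's inequality -/

theorem finrank_sumSMul_W_le (r : ℕ) (g : Fin p → M) :
    Module.finrank K (sumSMul (W K n r) g) ≤ p * (r + 1) ^ (2 * n) := by
  let u : Fin p × (Fin n ⊕ Fin n → Fin (r + 1)) → M := fun q => vec (K := K) g (q.1, fun k => q.2 k)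
  have hle : sumSMul (W K n r) g ≤ Submodule.span K (Set.range u) := by
    rw [sumSMul_W]
    refine Submodule.span_mono ?_
    rintro _ ⟨⟨i, a⟩, ha, rfl⟩
    exact ⟨(i, fun k => ⟨a k, Nat.lt_succ_of_le ((le_fiberSum _ a k).trans (ha ()))⟩), rfl⟩
  have := FiniteDimensional.span_of_finite K (Set.finite_range u)
  refine (Submodule.finrank_mono hle).trans ((finrank_range_le_card u).trans_eq ?_)
  simp [two_mul]

variable [CharZero K]

/-- An operator of order less than `r` annihilating `W_(r - 1) g_1 + ⋯ + W_(r - 1) g_p` is zero. Its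
commutators with the generators of the Weyl algebra have order less than `r - 1` and annihilate
`W_(r - 2) g_1 + ⋯ + W_(r - 2) g_p`, so by induction it is central, hence a scalar. -/
theorem eq_zero_of_smul_sumSMul_eq_zero [Nontrivial M] {g : Fin p → M}
    (hg : Submodule.span (WeylAlgebra K n) (Set.range g) = ⊤) (r : ℕ) :
    ∀ D ∈ W K n ((r : ℤ) - 1), (∀ m ∈ sumSMul (W K n ((r : ℤ) - 1)) g, D • m = 0) → D = 0 := by
  induction r with
  | zero =>
    intro D hD _
    rwa [W_eq_bot (by norm_num), Submodule.mem_bot] at hD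
  | succ r ih =>
    intro D hD hkill
    rw [Nat.cast_add_one, add_sub_cancel_right] at hD hkill
    have hmono : ∀ m ∈ sumSMul (W K n ((r : ℤ) - 1)) g, m ∈ sumSMul (W K n (r : ℤ)) g := fun m hm =>
      sumSMul_mono (W_mono (sub_le_self _ zero_le_one)) g hm
    have hgen : ∀ y ∈ W K n 1, ∀ m ∈ sumSMul (W K n ((r : ℤ) - 1)) g, D • y • m = 0 := by
      intro y hy m hm
      refine hkill _ ?_
      have := smul_mem_sumSMul_W hy hm
      rwa [add_sub_cancel] at this
    obtain ⟨c, rfl⟩ : ∃ c : K, D = c • 1 := by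
      refine exists_eq_smul_one_of_commute (fun k => ?_) fun k => ?_
      · obtain ⟨E, hE, h⟩ := exists_mul_x_eq k hD
        rw [h, ih E hE fun m hm => ?_, add_zero]
        have h1 := congrArg (· • m) h
        simp only [add_smul, mul_smul] at h1
        rwa [hgen _ (x_mem_W k) m hm, hkill m (hmono m hm), smul_zero, zero_add, eq_comm] at h1
      · obtain ⟨E, hE, h⟩ := exists_d_mul_eq k hD
        rw [h, ih E hE fun m hm => ?_, add_zero]
        have h1 := congrArg (· • m) h
        simp only [add_smul, mul_smul] at h1
        rwa [hgen _ (d_mem_W k) m hm, hkill m (hmono m hm), smul_zero, zero_add, eq_comm] at h1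
    obtain ⟨i, hi⟩ : ∃ i, g i ≠ 0 := by
      by_contra! hc
      have : Submodule.span (WeylAlgebra K n) (Set.range g) = ⊥ := by
        rw [Submodule.span_eq_bot]
        rintro _ ⟨i, rfl⟩
        exact hc i
      exact bot_ne_top (this.symm.trans hg)
    have h1 := hkill (g i) (by
      have := smul_mem_sumSMul (one_mem_W (K := K) (n := n) (Int.natCast_nonneg r)) g i
      rwa [one_smul] at this)
    rw [smul_assoc, one_smul] at h1
    rw [(smul_eq_zero.1 h1).resolve_right hi, zero_smul]

/-- Bernstein's inequality in finite form: the operators of order at most `r` embed into the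
linear maps from `W_r g_1 + ⋯ + W_r g_p` to `W_(2r) g_1 + ⋯ + W_(2r) g_p`. -/
theorem pow_le_finrank_mul_finrank [Nontrivial M] {g : Fin p → M}
    (hg : Submodule.span (WeylAlgebra K n) (Set.range g) = ⊤) {r t : ℕ} (hrt : 2 * n * t ≤ r) :
    (t + 1) ^ (2 * n) ≤ Module.finrank K (sumSMul (W K n r) g) *
      Module.finrank K (sumSMul (W K n (2 * r : ℕ)) g) := by
  let mon : (Fin n → Fin (t + 1)) × (Fin n → Fin (t + 1)) → WeylAlgebra K n := fun q =>
    monomial K (fun i => (q.1 i : ℕ)) (fun i => (q.2 i : ℕ))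
  have hmon : ∀ q, mon q ∈ W K n r := by
    intro q
    have hsum : ∀ f : Fin n → Fin (t + 1), ∑ i, (f i : ℕ) ≤ n * t := fun f =>
      (Finset.sum_le_card_nsmul _ _ t fun i _ => Nat.lt_succ_iff.1 (f i).2).trans_eq (by simp)
    refine monomial_mem_W (Int.ofNat_le.2 ?_)
    have h1 := hsum q.1
    have h2 := hsum q.2
    linarith
  have hmap : ∀ q, ∀ m ∈ sumSMul (W K n r) g,
      Algebra.lsmul K K M (mon q) m ∈ sumSMul (W K n (2 * r : ℕ)) g := by
    intro q m hm
    have := smul_mem_sumSMul_W (hmon q) hm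
    rwa [← Nat.cast_add, ← two_mul] at this
  let Φ := fun q => (Algebra.lsmul K K M (mon q)).restrict (hmap q)
  have hind : LinearIndependent K Φ := by
    rw [Fintype.linearIndependent_iff]
    intro c hc
    have h0 : ∑ q, c q • mon q = 0 := by
      refine eq_zero_of_smul_sumSMul_eq_zero hg (r + 1) _ ?_ ?_
      · rw [Nat.cast_add_one, add_sub_cancel_right]
        exact sum_mem fun q _ => Submodule.smul_mem _ _ (hmon q)
      · intro m hm
        rw [Nat.cast_add_one, add_sub_cancel_right] at hm
        have h1 := congrArg (fun f => ((f ⟨m, hm⟩ : sumSMul (W K n (2 * r : ℕ)) g) : M)) hc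
        rw [Finset.sum_smul]
        simp only [LinearMap.sum_apply, LinearMap.smul_apply, Submodule.coe_sum,
          Submodule.coe_smul, LinearMap.zero_apply, Submodule.coe_zero] at h1
        rw [← h1]
        refine Finset.sum_congr rfl fun q _ => ?_
        rw [smul_assoc]
        rfl
    let e : (Fin n → Fin (t + 1)) × (Fin n → Fin (t + 1)) ↪ (Fin n → ℕ) × (Fin n → ℕ) :=
      ⟨fun q => (fun i => (q.1 i : ℕ), fun i => (q.2 i : ℕ)), fun q q' h => by
        obtain ⟨h1, h2⟩ := Prod.mk.inj h
        exact Prod.ext (funext fun i => Fin.ext (congrFun h1 i))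
          (funext fun i => Fin.ext (congrFun h2 i))⟩
    have h2 := eq_zero_of_sum_smul_monomial_eq_zero (K := K) (Finset.univ.map e)
      (Function.extend e c 0) (by
        rw [Finset.sum_map, ← h0]
        refine Finset.sum_congr rfl fun q _ => ?_
        rw [e.injective.extend_apply]
        rfl)
    intro q
    have h3 := h2 (e q) (Finset.mem_map_of_mem e (Finset.mem_univ q))
    rwa [e.injective.extend_apply] at h3
  have h1 := hind.fintype_card_le_finrank
  rw [Module.finrank_linearMap] at h1
  refine le_trans (le_of_eq ?_) h1
  simp [two_mul, pow_add]

end Filtration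

end WeylAlgebra

namespace WeylAlgebra

/-! ### Bernstein and characteristic polynomials -/

section Polynomials

open Filter

variable {K : Type*} [Field K] {n : ℕ} {M : Type*} [AddCommGroup M] [Module K M]
  [Module (WeylAlgebra K n) M] [IsScalarTower K (WeylAlgebra K n) M] {p : ℕ}

theorem exists_isBernsteinPolynomial (g : Fin p → M) :
    ∃ ψ, IsBernsteinPolynomial (K := K) (n := n) g ψ := by
  obtain ⟨P, d₀, hP⟩ :=
    eventuallyPolynomial_finrank_span_vec (K := K) (fun _ : Fin n ⊕ Fin n => ()) g
  refine ⟨MvPolynomial.alongLine (fun _ => 1) P, d₀ (), fun r hr => ?_⟩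
  lift r to ℕ using (Int.natCast_nonneg _).trans hr
  rw [sumSMul_W, ← hP (fun _ => r) fun _ => Int.ofNat_le.1 hr, MvPolynomial.eval_alongLine]
  simp

theorem exists_isCharacteristicPolynomial (g : Fin p → M) :
    ∃ φ, IsCharacteristicPolynomial (K := K) (n := n) g φ := by
  obtain ⟨P, d₀, hP⟩ := eventuallyPolynomial_finrank_span_vec (K := K)
    (Sum.elim (fun _ : Fin n => (0 : Fin 2)) (fun _ : Fin n => 1)) g
  refine ⟨P, d₀ 0, d₀ 1, fun r s hr hs => ?_⟩
  lift r to ℕ using (Int.natCast_nonneg _).trans hr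
  lift s to ℕ using (Int.natCast_nonneg _).trans hs
  rw [sumSMul_W₂, ← hP ![r, s]]
  · congr 2
    funext j
    fin_cases j <;> simp
  · intro j
    fin_cases j
    · exact Int.ofNat_le.1 hr
    · exact Int.ofNat_le.1 hs

theorem IsBernsteinPolynomial.eventually_eval_eq {g : Fin p → M} {ψ : Polynomial ℚ}
    (h : IsBernsteinPolynomial (K := K) (n := n) g ψ) :
    ∀ᶠ t : ℕ in atTop, ψ.eval (t : ℚ) = Module.finrank K (sumSMul (W K n t) g) := by
  obtain ⟨r₀, h⟩ := h
  filter_upwards [eventually_ge_atTop r₀.toNat] with t ht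
  exact h t (Int.toNat_le.1 ht)

theorem IsBernsteinPolynomial.unique {g : Fin p → M} {ψ ψ' : Polynomial ℚ}
    (h : IsBernsteinPolynomial (K := K) (n := n) g ψ)
    (h' : IsBernsteinPolynomial (K := K) (n := n) g ψ') : ψ = ψ' := by
  refine Polynomial.eq_of_eventually_eval_eq ?_
  filter_upwards [h.eventually_eval_eq, h'.eventually_eval_eq] with t h1 h2
  rw [h1, h2]

theorem IsCharacteristicPolynomial.exists_eval_eq {g : Fin p → M} {φ : MvPolynomial (Fin 2) ℚ}
    (h : IsCharacteristicPolynomial (K := K) (n := n) g φ) :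
    ∃ d₀ : Fin 2 → ℕ, ∀ d : Fin 2 → ℕ, d₀ ≤ d → MvPolynomial.eval (fun j => (d j : ℚ)) φ =
      Module.finrank K (sumSMul (W₂ K n (d 0) (d 1)) g) := by
  obtain ⟨r₀, s₀, h⟩ := h
  refine ⟨![r₀.toNat, s₀.toNat], fun d hd => ?_⟩
  rw [← h (d 0) (d 1) (Int.toNat_le.1 (hd 0)) (Int.toNat_le.1 (hd 1))]
  congr 2
  funext j
  fin_cases j <;> simp

theorem IsCharacteristicPolynomial.unique {g : Fin p → M} {φ φ' : MvPolynomial (Fin 2) ℚ}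
    (h : IsCharacteristicPolynomial (K := K) (n := n) g φ)
    (h' : IsCharacteristicPolynomial (K := K) (n := n) g φ') : φ = φ' := by
  obtain ⟨d₁, h1⟩ := h.exists_eval_eq
  obtain ⟨d₂, h2⟩ := h'.exists_eval_eq
  refine MvPolynomial.eq_of_eval_natCast_eq (d₁ ⊔ d₂) fun d hd => ?_
  rw [h1 d (le_sup_left.trans hd), h2 d (le_sup_right.trans hd)]

/-- The polynomial `φ(t, t)` is the restriction of `φ` to the diagonal, and its degree is the total
degree of `φ` because the dimensions are nonnegative and monotone. -/
theorem IsCharacteristicPolynomial.natDegree_alongLine {g : Fin p → M}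
    {φ : MvPolynomial (Fin 2) ℚ} (h : IsCharacteristicPolynomial (K := K) (n := n) g φ) :
    (MvPolynomial.alongLine (fun _ => 1) φ).natDegree = φ.totalDegree := by
  obtain ⟨d₀, h⟩ := h.exists_eval_eq
  refine MvPolynomial.natDegree_alongLine_one_eq_totalDegree d₀ (fun d hd => ?_)
    fun d d' hd hdd' => ?_
  · rw [h d hd]
    exact Nat.cast_nonneg _
  · rw [h d hd, h d' (hd.trans hdd')]
    exact Nat.cast_le.2 (Submodule.finrank_mono (sumSMul_mono
      (W₂_mono (Int.ofNat_le.2 (hdd' 0)) (Int.ofNat_le.2 (hdd' 1))) g))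

theorem eventually_eval_le_and_le {g : Fin p → M} {ψ : Polynomial ℚ} {φ : MvPolynomial (Fin 2) ℚ}
    (hψ : IsBernsteinPolynomial (K := K) (n := n) g ψ)
    (hφ : IsCharacteristicPolynomial (K := K) (n := n) g φ) :
    ∃ r₀ : ℤ, ∀ r : ℤ, r₀ ≤ r →
      ψ.eval (r : ℚ) ≤ MvPolynomial.eval ![(r : ℚ), (r : ℚ)] φ ∧
      MvPolynomial.eval ![(r : ℚ), (r : ℚ)] φ ≤ ψ.eval (2 * r : ℚ) := by
  obtain ⟨r₀, h1⟩ := hψ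
  obtain ⟨r₁, s₁, h2⟩ := hφ
  refine ⟨max 0 (max r₀ (max r₁ s₁)), fun r hr => ?_⟩
  simp only [max_le_iff] at hr
  obtain ⟨hr0, hr1, hr2, hr3⟩ := hr
  have h3 := h1 (2 * r) (by linarith)
  rw [Int.cast_mul, Int.cast_ofNat] at h3
  rw [h1 r hr1, h2 r r hr2 hr3, h3]
  lift r to ℕ using hr0
  refine ⟨Nat.cast_le.2 (Submodule.finrank_mono (sumSMul_mono (W_le_W₂ _) g)), Nat.cast_le.2 ?_⟩
  refine Submodule.finrank_mono (t := sumSMul (W K n (2 * r : ℕ)) g) ?_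
  refine sumSMul_mono ((W₂_le_W _ _).trans (W_mono ?_)) g
  push_cast
  linarith

theorem natDegree_eq_natDegree_alongLine {g : Fin p → M} {ψ : Polynomial ℚ}
    {φ : MvPolynomial (Fin 2) ℚ} (hψ : IsBernsteinPolynomial (K := K) (n := n) g ψ)
    (hφ : IsCharacteristicPolynomial (K := K) (n := n) g φ) :
    ψ.natDegree = (MvPolynomial.alongLine (fun _ => 1) φ).natDegree := by
  obtain ⟨r₀, h⟩ := eventually_eval_le_and_le hψ hφ
  have hdiag : ∀ t : ℕ, (MvPolynomial.alongLine (fun _ => 1) φ).eval (t : ℚ) =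
      MvPolynomial.eval ![((t : ℤ) : ℚ), ((t : ℤ) : ℚ)] φ := by
    intro t
    rw [MvPolynomial.eval_alongLine]
    congr 2
    funext j
    fin_cases j <;> simp
  have h1 : ψ.degree ≤ (MvPolynomial.alongLine (fun _ => 1) φ).degree := by
    refine Polynomial.degree_le_of_eventually_eval_le ?_
    filter_upwards [hψ.eventually_eval_eq, eventually_ge_atTop r₀.toNat] with t h2 ht
    have h3 := h t (Int.toNat_le.1 ht)
    rw [hdiag]
    exact ⟨h2 ▸ Nat.cast_nonneg _, h3.1⟩
  have h2 : (MvPolynomial.alongLine (fun _ => 1) φ).degree ≤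
      (ψ.comp (Polynomial.C 2 * Polynomial.X)).degree := by
    refine Polynomial.degree_le_of_eventually_eval_le ?_
    filter_upwards [hψ.eventually_eval_eq, eventually_ge_atTop r₀.toNat] with t h2 ht
    have h3 := h t (Int.toNat_le.1 ht)
    rw [hdiag, Polynomial.eval_comp, Polynomial.eval_mul, Polynomial.eval_C, Polynomial.eval_X]
    refine ⟨le_trans ?_ h3.1, h3.2⟩
    exact h2 ▸ Nat.cast_nonneg _
  refine (Polynomial.natDegree_le_natDegree h1).antisymm
    ((Polynomial.natDegree_le_natDegree h2).trans_eq ?_)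
  rw [Polynomial.natDegree_comp, Polynomial.natDegree_C_mul_X _ two_ne_zero, mul_one]

theorem IsBernsteinPolynomial.natDegree_le {g : Fin p → M} {ψ : Polynomial ℚ}
    (hψ : IsBernsteinPolynomial (K := K) (n := n) g ψ) : ψ.natDegree ≤ 2 * n := by
  have h : ψ.degree ≤
      (Polynomial.C (p : ℚ) * (Polynomial.X + Polynomial.C 1) ^ (2 * n)).degree := by
    refine Polynomial.degree_le_of_eventually_eval_le ?_
    filter_upwards [hψ.eventually_eval_eq] with t ht
    rw [ht]
    refine ⟨Nat.cast_nonneg _, ?_⟩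
    have := finrank_sumSMul_W_le (K := K) (n := n) t g
    simp only [Polynomial.eval_mul, Polynomial.eval_pow, Polynomial.eval_add, Polynomial.eval_X,
      Polynomial.eval_C]
    exact_mod_cast this
  refine (Polynomial.natDegree_le_natDegree h).trans ((Polynomial.natDegree_C_mul_le _ _).trans ?_)
  rw [Polynomial.natDegree_pow, Polynomial.natDegree_X_add_C, mul_one]

/-- The degree of a Bernstein polynomial of a system of generators bounds that of every finite
system, so that it does not depend on the system of generators. -/
theorem IsBernsteinPolynomial.degree_le {p' : ℕ} {g : Fin p → M} {g' : Fin p' → M}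
    {ψ ψ' : Polynomial ℚ} (hg : Submodule.span (WeylAlgebra K n) (Set.range g) = ⊤)
    (hψ : IsBernsteinPolynomial (K := K) (n := n) g ψ)
    (hψ' : IsBernsteinPolynomial (K := K) (n := n) g' ψ') : ψ'.degree ≤ ψ.degree := by
  obtain ⟨k, hk⟩ := exists_sumSMul_W_le hg g'
  rw [← Polynomial.degree_taylor ψ (k : ℚ)]
  refine Polynomial.degree_le_of_eventually_eval_le ?_
  filter_upwards [(tendsto_add_atTop_nat k).eventually hψ.eventually_eval_eq,
    hψ'.eventually_eval_eq] with t h1 h2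
  rw [Polynomial.taylor_eval, ← Nat.cast_add, h1, h2]
  exact ⟨Nat.cast_nonneg _, Nat.cast_le.2 (Submodule.finrank_mono (hk t))⟩

/-- Bernstein's inequality. -/
theorem IsBernsteinPolynomial.le_degree [CharZero K] [Nontrivial M] {g : Fin p → M}
    {ψ : Polynomial ℚ} (hg : Submodule.span (WeylAlgebra K n) (Set.range g) = ⊤)
    (hψ : IsBernsteinPolynomial (K := K) (n := n) g ψ) : (n : WithBot ℕ) ≤ ψ.degree := by
  let ℓ : ℕ → Polynomial ℚ := fun c => Polynomial.C (c : ℚ) * Polynomial.X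
  have hℓ : ∀ c, (ψ.comp (ℓ c)).natDegree ≤ ψ.natDegree := fun c =>
    Polynomial.natDegree_comp_le.trans <| (Nat.mul_le_mul_left _
      ((Polynomial.natDegree_C_mul_le _ _).trans Polynomial.natDegree_X_le)).trans_eq (mul_one _)
  -- `2n + 1` in place of `2n` keeps the scaling factor positive for `n = 0`.
  have h : ((Polynomial.X + Polynomial.C (1 : ℚ)) ^ (2 * n)).degree ≤
      (ψ.comp (ℓ (2 * n + 1)) * ψ.comp (ℓ (2 * (2 * n + 1)))).degree := by
    refine Polynomial.degree_le_of_eventually_eval_le ?_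
    have hc : ∀ c : ℕ, 0 < c → ∀ᶠ t : ℕ in atTop, ψ.eval ((c : ℚ) * t) =
        Module.finrank K (sumSMul (W K n (c * t : ℕ)) g) := by
      intro c hc
      have := (tendsto_id.const_mul_atTop' hc).eventually hψ.eventually_eval_eq
      simpa only [id, Nat.cast_mul] using this
    filter_upwards [hc (2 * n + 1) (by omega), hc (2 * (2 * n + 1)) (by omega)] with t h1 h2
    have h3 := pow_le_finrank_mul_finrank hg (r := (2 * n + 1) * t) (t := t)
      (Nat.mul_le_mul_right t (Nat.le_succ _))
    rw [← mul_assoc] at h3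
    simp only [ℓ, Polynomial.eval_mul, Polynomial.eval_comp, Polynomial.eval_pow,
      Polynomial.eval_add, Polynomial.eval_X, Polynomial.eval_C, h1, h2]
    exact ⟨by positivity, by exact_mod_cast h3⟩
  rw [Polynomial.degree_pow, Polynomial.degree_X_add_C] at h
  have hψ0 : ψ ≠ 0 := by
    rintro rfl
    simp only [Polynomial.zero_comp, zero_mul, Polynomial.degree_zero, le_bot_iff] at h
    norm_cast at h
  rw [Polynomial.degree_eq_natDegree hψ0, Nat.cast_le]
  have h1 := h.trans Polynomial.degree_le_natDegree
  have h2 := (Polynomial.natDegree_mul_le (p := ψ.comp (ℓ (2 * n + 1)))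
    (q := ψ.comp (ℓ (2 * (2 * n + 1))))).trans (add_le_add (hℓ _) (hℓ _))
  rw [nsmul_one, Nat.cast_le] at h1
  omega

end Polynomials

end WeylAlgebra
theorem mainTheorem3 {K : Type*} [Field K] [CharZero K] (n : ℕ)
    {M : Type*} [AddCommGroup M] [Nontrivial M] [Module K M] [Module (WeylAlgebra K n) M]
    [IsScalarTower K (WeylAlgebra K n) M]
    {p : ℕ} (g : Fin p → M) (hg : Submodule.span (WeylAlgebra K n) (Set.range g) = ⊤) :
    (∀ r : ℕ, WeylAlgebra.W K n r ≤ WeylAlgebra.W₂ K n r r ∧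
      WeylAlgebra.W₂ K n r r ≤ WeylAlgebra.W K n (2 * r)) ∧
    ∃ (ψ : Polynomial ℚ) (φ : MvPolynomial (Fin 2) ℚ),
      (∀ ψ' : Polynomial ℚ,
        WeylAlgebra.IsBernsteinPolynomial (K := K) (n := n) g ψ' ↔ ψ' = ψ) ∧
      (∀ φ' : MvPolynomial (Fin 2) ℚ,
        WeylAlgebra.IsCharacteristicPolynomial (K := K) (n := n) g φ' ↔ φ' = φ) ∧
      (∃ r₀ : ℤ, ∀ r : ℤ, r₀ ≤ r →
        ψ.eval (r : ℚ) ≤ MvPolynomial.eval ![(r : ℚ), (r : ℚ)] φ ∧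
        MvPolynomial.eval ![(r : ℚ), (r : ℚ)] φ ≤ ψ.eval (2 * r : ℚ)) ∧
      (n : WithBot ℕ) ≤ ψ.degree ∧
      ψ.degree = (φ.totalDegree : WithBot ℕ) ∧
      φ.totalDegree ≤ 2 * n ∧
      (WeylAlgebra.InBernsteinClass K n M ↔ φ.totalDegree = n) := by
  obtain ⟨ψ, hψ⟩ := WeylAlgebra.exists_isBernsteinPolynomial (K := K) (n := n) g
  obtain ⟨φ, hφ⟩ := WeylAlgebra.exists_isCharacteristicPolynomial (K := K) (n := n) g
  have hle := hψ.le_degree hg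
  have hdeg : ψ.natDegree = φ.totalDegree :=
    (WeylAlgebra.natDegree_eq_natDegree_alongLine hψ hφ).trans hφ.natDegree_alongLine
  have hψ0 : ψ ≠ 0 := by
    rintro rfl
    rw [Polynomial.degree_zero, le_bot_iff] at hle
    exact WithBot.coe_ne_bot hle
  have hdeg' : ψ.degree = (φ.totalDegree : WithBot ℕ) := by
    rw [Polynomial.degree_eq_natDegree hψ0, hdeg]
  refine ⟨fun r => ⟨WeylAlgebra.W_le_W₂ r, ?_⟩, ψ, φ, ?_, ?_, ?_, hle, hdeg',
    hdeg ▸ hψ.natDegree_le, ?_, ?_⟩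
  · rw [two_mul]
    exact WeylAlgebra.W₂_le_W r r
  · exact fun ψ' => ⟨fun h => h.unique hψ, fun h => h ▸ hψ⟩
  · exact fun φ' => ⟨fun h => h.unique hφ, fun h => h ▸ hφ⟩
  · exact WeylAlgebra.eventually_eval_le_and_le hψ hφ
  · rintro ⟨p', g', ψ', hg', hψ', hn⟩
    have h : ψ.degree = ψ'.degree := (hψ'.degree_le hg' hψ).antisymm (hψ.degree_le hg hψ')
    rw [hdeg', hn] at h
    exact_mod_cast h
  · intro h
    exact ⟨p, g, ψ, hg, hψ, by rw [hdeg', h]⟩
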